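/- Let $n\ge 1$, $R\in(0,+\infty]$, and let $\xi\in C^\infty([0,R))$ satisfy $\xi>0$ on $(0,R)$, $\xi^{(2k)}(0)=0$ for all integers $k\ge 0$, and $\xi'(0)=1$. Let $P$ be the $n$-dimensional model manifold with pole $o$ and metric $dr^2+\xi(r)^2d\theta^2$ on $(0,R)\times\mathbb S^{n-1}$, extended smoothly across $o$; let $B_r(o)$ be its balls about $o$. Let $\psi=\psi(r)$ be a radial function that is smooth on $P$, and let $M=P\times_{e^{-\psi}}\mathbb R$ carry the metric $e^{-2\psi(r)}ds^2+dr^2+\xi(r)^2d\theta^2$, with Killing field $Y=\partial_s$. For the Killing graph $\{s=f(x)\}$ of a function $f$, let $N$ be the unit normal with $\langle N,Y\rangle>0$, let $H$ be the mean curvature with respect to $N$ (so $nH=-\mathrm{div}_\Sigma N$), and let $H_\psi=H+\frac1n\langle\nabla\psi,N\rangle$ be the weighted mean curvature. Put $$A_\psi(r)=e^{-2\psi(r)}\xi(r)^{n-1},\qquad V_\psi(r)=\int_0^r e^{-2\psi(\tau)}\xi(\tau)^{n-1}\,d\tau .$$ Suppose that $A_\psi/V_\psi$ is non-increasing on $(0,R)$.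 Let $r_0\in(0,R)$ and let $H_0\in\mathbb R$ satisfy $$n|H_0|=\frac{A_\psi(r_0)}{V_\psi(r_0)},$$ and suppose that $(A_\psi/V_\psi)'(r_0)<0$. Put $I(r)=\int_0^r nH_0\,e^{-2\psi(\tau)}\xi(\tau)^{n-1}\,d\tau$. Then the integrals below converge, and the function $$u(r)=\int_{r_0}^{r} e^{\psi(\tau)}\frac{I(\tau)}{\sqrt{e^{-4\psi(\tau)}\xi(\tau)^{2(n-1)}-I(\tau)^2}}\,d\tau,\qquad r\in[0,r_0],$$ defines a radial function on $\overline{B_{r_0}(o)}$, continuous there and smooth on the open ball $B_{r_0}(o)$ (including at $o$), whose Killing graph $\Sigma_0$ is a compact, rotationally symmetric, smooth embedded hypersurface with boundary $\partial\Sigma_0=\partial B_{r_0}(o)\times\{0\}$ and has constant weighted mean curvature $H_\psi=H_0$ at all its points over $B_{r_0}(o)$. Moreover, for every $r\in[0,r_0]$, $$e^{-\psi(r)}|u(r)|\le e^{\sup_{B_{r_0}(o)}\psi-\inf_{B_{r_0}(o)}\psi}\int_0^{r_0}\frac{n|H_0|}{\sqrt{\dfrac{A_\psi(\tau)^2}{V_\psi(\tau)^2}-n^2H_0^2}}\,d\tau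 .$$ In particular, if $H_0<0$, then $u\ge 0$ and this bounds $e^{-\psi(r)}u(r)$, with $n|H_0|=-nH_0$. -/

import Mathlib

open scoped ContDiff

noncomputable section

namespace KillingGraph

/-- Coordinates `x = r θ` centred at the pole, so that `r = ‖x‖` and `θ = x / ‖x‖`. -/
abbrev Base (n : ℕ) := EuclideanSpace ℝ (Fin n)

/-- Coordinates `(x, s)` on `P × ℝ`. -/
abbrev Ambient (n : ℕ) := EuclideanSpace ℝ (Fin n) × ℝ

/-- The interval `[0, R)`, where `R` may be `+∞`. -/
def radii (R : EReal) : Set ℝ := {r : ℝ | 0 ≤ r ∧ (r : EReal) < R}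

/-- The model space `P` as a manifold: the ball `{‖x‖ < R}` about the pole `o = 0`. -/
def modelBall (n : ℕ) (R : EReal) : Set (Base n) := {x : Base n | ((‖x‖ : ℝ) : EReal) < R}

/-- `ξ` is the warping function of a model space of radius `R`: smooth on `[0, R)`, positive on
`(0, R)`, with all derivatives of even order vanishing at `0` and `ξ'(0) = 1`. -/
structure IsWarpingFunction (R : EReal) (ξ : ℝ → ℝ) : Prop where
  smooth : ContDiffOn ℝ ∞ ξ (radii R)
  pos : ∀ r : ℝ, 0 < r → (r : EReal) < R → 0 < ξ r
  even_deriv : ∀ k : ℕ, iteratedDerivWithin (2 * k) ξ (radii R) 0 = 0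
  deriv_one : derivWithin ξ (radii R) 0 = 1

/-- A (0,2)-tensor field on a vector space `V`: `G p v w` is its value at `p` on `v`, `w`. -/
abbrev TensorField (V : Type*) := V → V → V → ℝ

/-- The metric `dr² + ξ(r)² dθ²` in the coordinates `x = r θ`. At `x ≠ 0`, `dr` is
`v ↦ ⟪x, v⟫ / ‖x‖` and `r² dθ²` is the Euclidean metric minus `dr²`; at the pole the metric is the
Euclidean one. -/
def modelMetric {n : ℕ} (ξ : ℝ → ℝ) : TensorField (Base n) := fun x v w =>
  if x = 0 then inner ℝ v w
  else
    (inner ℝ x v / ‖x‖) * (inner ℝ x w / ‖x‖)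
      + (ξ ‖x‖ / ‖x‖) ^ 2 * (inner ℝ v w - (inner ℝ x v / ‖x‖) * (inner ℝ x w / ‖x‖))

/-- The metric `e^{-2ψ(r)} ds² + dr² + ξ(r)² dθ²` of the warped product `P ×_{e^{-ψ}} ℝ`. -/
def ambientMetric {n : ℕ} (ξ ψ : ℝ → ℝ) : TensorField (Ambient n) := fun p v w =>
  modelMetric ξ p.1 v.1 w.1 + Real.exp (-2 * ψ ‖p.1‖) * (v.2 * w.2)

/-- `⟨Γ(a, b), c⟩` at `p`, where `Γ` are the Christoffel symbols of the Levi-Civita connection of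
`G` (Koszul formula on constant vector fields). -/
def christoffel {V : Type*} [NormedAddCommGroup V] [NormedSpace ℝ V] (G : TensorField V)
    (p a b c : V) : ℝ :=
  (fderiv ℝ (fun q => G q b c) p a + fderiv ℝ (fun q => G q a c) p b
    - fderiv ℝ (fun q => G q a b) p c) / 2

/-- The parametrization `x ↦ (x, f x)` of the Killing graph of `f`. -/
def graphMap {n : ℕ} (f : Base n → ℝ) : Base n → Ambient n := fun x => (x, f x)

/-- The Killing graph of `f` over the set `D`. -/
def graphOver {n : ℕ} (f : Base n → ℝ) (D : Set (Base n)) : Set (Ambient n) := graphMap f '' D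

/-- The induced metric (first fundamental form) `⟨dX v, dX w⟩` of a parametrized hypersurface. -/
def firstForm {n : ℕ} (G : TensorField (Ambient n)) (X : Base n → Ambient n) (x v w : Base n) : ℝ :=
  G (X x) (fderiv ℝ X x v) (fderiv ℝ X x w)

/-- The second fundamental form `⟨∇_{dX v} dX w, N⟩ = ⟨D²X(v, w) + Γ(dX v, dX w), N⟩` of a
parametrized hypersurface with respect to the normal vector `N` at `X x`. -/
def secondForm {n : ℕ} (G : TensorField (Ambient n)) (X : Base n → Ambient n) (N : Ambient n)
    (x v w : Base n) : ℝ :=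
  G (X x) (fderiv ℝ (fun y => fderiv ℝ X y w) x v) N
    + christoffel G (X x) (fderiv ℝ X x v) (fderiv ℝ X x w) N

/-- The Gram matrix of a bilinear form in the standard basis. -/
def gram {n : ℕ} (B : Base n → Base n → ℝ) : Matrix (Fin n) (Fin n) ℝ :=
  Matrix.of fun i j => B (EuclideanSpace.single i 1) (EuclideanSpace.single j 1)

/-- The mean curvature `H = (1/n) g^{ij} h_{ij}`: `1/n` times the trace of the second fundamental
form with respect to the first. Thus `n H = -div_Σ N`. -/
def meanCurvature {n : ℕ} (G : TensorField (Ambient n)) (X : Base n → Ambient n) (N : Ambient n)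
    (x : Base n) : ℝ :=
  ((gram (firstForm G X x))⁻¹ * gram (secondForm G X N x)).trace / n

/-- `N` is the upward pointing unit normal at `X x`: it is orthogonal to the hypersurface, of unit
length, and has positive inner product with the Killing field `Y = ∂/∂s = (0, 1)`. -/
structure IsUpwardNormal {n : ℕ} (G : TensorField (Ambient n)) (X : Base n → Ambient n)
    (x : Base n) (N : Ambient n) : Prop where
  orthogonal : ∀ v : Base n, G (X x) N (fderiv ℝ X x v) = 0
  unit : G (X x) N N = 1
  upward : 0 < G (X x) N (0, 1)

/-- The Killing graph of `f` in `P ×_{e^{-ψ}} ℝ` has, at the point over `x` and with respect to the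
upward pointing unit normal `N`, weighted mean curvature
`H_ψ = H + (1/n) ⟨∇ψ, N⟩ = H + (1/n) dψ(N)` equal to `h`. -/
def HasWeightedMeanCurvatureAt {n : ℕ} (ξ ψ : ℝ → ℝ) (f : Base n → ℝ) (x : Base n) (h : ℝ) :
    Prop :=
  ∃ N : Ambient n, IsUpwardNormal (ambientMetric ξ ψ) (graphMap f) x N ∧
    meanCurvature (ambientMetric ξ ψ) (graphMap f) N x
      + fderiv ℝ (fun q : Ambient n => ψ ‖q.1‖) (graphMap f x) N / n = h

/-- `S` is a smooth embedded hypersurface with boundary `B`: near a point of `S \ B` it is a regular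
level set `{F = 0}`, and near a point of `B` it is `{F = 0, G ≥ 0}`, with `B` given by
`{F = 0, G = 0}`, where `dF` and `dG` are linearly independent. -/
structure IsSmoothHypersurfaceWithBoundary {V : Type*} [NormedAddCommGroup V] [NormedSpace ℝ V]
    (S B : Set V) : Prop where
  subset : B ⊆ S
  interior : ∀ p ∈ S \ B, ∃ (O : Set V) (F : V → ℝ), IsOpen O ∧ p ∈ O ∧ ContDiffOn ℝ ∞ F O ∧
    fderiv ℝ F p ≠ 0 ∧ ∀ q ∈ O, (q ∈ S ↔ F q = 0)
  boundary : ∀ p ∈ B, ∃ (O : Set V) (F G : V → ℝ), IsOpen O ∧ p ∈ O ∧ ContDiffOn ℝ ∞ F O ∧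
    ContDiffOn ℝ ∞ G O ∧ LinearIndependent ℝ ![fderiv ℝ F p, fderiv ℝ G p] ∧
    (∀ q ∈ O, (q ∈ S ↔ F q = 0 ∧ 0 ≤ G q)) ∧ (∀ q ∈ O, (q ∈ B ↔ F q = 0 ∧ G q = 0))

/-- `A_ψ(r) = e^{-2ψ(r)} ξ(r)^{n-1}`. -/
def weightedArea (n : ℕ) (ξ ψ : ℝ → ℝ) (r : ℝ) : ℝ := Real.exp (-2 * ψ r) * ξ r ^ (n - 1)

/-- `V_ψ(r) = ∫₀^r e^{-2ψ} ξ^{n-1}`. -/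
def weightedVolume (n : ℕ) (ξ ψ : ℝ → ℝ) (r : ℝ) : ℝ := ∫ τ in (0 : ℝ)..r, weightedArea n ξ ψ τ

/-- `I(r) = ∫₀^r n H₀ e^{-2ψ} ξ^{n-1}`. -/
def flux (n : ℕ) (ξ ψ : ℝ → ℝ) (H₀ r : ℝ) : ℝ :=
  ∫ τ in (0 : ℝ)..r, n * H₀ * Real.exp (-2 * ψ τ) * ξ τ ^ (n - 1)

/-- The slope `e^ψ I / √(e^{-4ψ} ξ^{2(n-1)} - I²)` of the radial solution. -/
def radialSlope (n : ℕ) (ξ ψ : ℝ → ℝ) (H₀ τ : ℝ) : ℝ :=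
  Real.exp (ψ τ) * (flux n ξ ψ H₀ τ
    / Real.sqrt (Real.exp (-4 * ψ τ) * ξ τ ^ (2 * (n - 1)) - flux n ξ ψ H₀ τ ^ 2))

/-- The integrand `n |H₀| / √(A_ψ² / V_ψ² - n² H₀²)` of the height bound. -/
def heightDensity (n : ℕ) (ξ ψ : ℝ → ℝ) (H₀ τ : ℝ) : ℝ :=
  n * |H₀| / Real.sqrt (weightedArea n ξ ψ τ ^ 2 / weightedVolume n ξ ψ τ ^ 2 - (n : ℝ) ^ 2 * H₀ ^ 2)

end KillingGraph

end

open KillingGraph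

/-!
The profile `u` is the primitive of the slope `p = e^ψ I / √(A² - I²)`, where `A = A_ψ`, `V = V_ψ`
and `I = n H₀ V`. Strict decrease of `A / V` at `r₀` and monotonicity give `|I| < A` on `(0, r₀)`
(`IsCriticalRadius.flux_sq_lt`), and `A² - I²` has a simple zero at `r₀`.

*Mean curvature.* In the coordinates `x = r θ` both fundamental forms of a rotationally symmetric
graph are combinations of `dr²` and `r² dθ²`, so that the trace is explicit
(`hasWeightedMeanCurvatureAt_of_ne_zero`). The radial component of the upward unit normal is `-ν p`
with `ν p = I / A`, and the equation `H_ψ = H₀` becomes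
`(A ν p)' = n H₀ A`, which is the definition of `I`. Over the pole the metric is Euclidean to first
order and the mean curvature is read off from the Hessian (`hasWeightedMeanCurvatureAt_zero`).

*Smoothness at the pole.* The conditions on `ξ` make `ξ / r` a smooth even function
(`KillingGraph.IsWarpingFunction.exists_isRegularModel`), and a smooth even function of `‖x‖` is
smooth (`contDiffOn_comp_norm_of_even`). Hence `V / r^n` and `p / r` are smooth radial functions,
and since `p / r` is the factor in `∇u = (p / r) x`, so is `u`. All divisions by `r` are carried out by
averaging dilates (`contDiffOn_integral_smul_comp_smul`).

*The boundary.* Near `r₀` the slope is `κ(r) / √(r₀ - r)` with `κ` smooth and of the sign of `H₀`,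
so that it is integrable and `u = -√(r₀ - r) m(r)` with `m` smooth (`exists_integral_eq_sqrt_mul`). The
graph is therefore `{s² = (r₀ - r) m(r)², H₀ s ≤ 0}` near its boundary, a regular level set cut by
a transversal half-space.

*Height.* The height density is `e^{-ψ} |p|` (`IsCriticalRadius.abs_radialSlope`), and the bound
follows by integrating.
-/

open KillingGraph
open Set Filter Topology MeasureTheory
open scoped ContDiff Interval

universe u

/-! ### Integrals of dilates -/

theorem hasFDerivAt_integral_smul_comp_smul {E F : Type*} [NormedAddCommGroup E] [NormedSpace ℝ E]
    [ProperSpace E] [NormedAddCommGroup F] [NormedSpace ℝ F] {ρ : ℝ} {f : E → F}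
    (hf : ContDiffOn ℝ ∞ f (Metric.ball 0 ρ)) {a c : ℝ → ℝ} (ha : Continuous a)
    (hc : Continuous c) (ha1 : ∀ t ∈ Icc (0 : ℝ) 1, |a t| ≤ 1) {x : E}
    (hx : x ∈ Metric.ball 0 ρ) :
    HasFDerivAt (fun y => ∫ t in (0 : ℝ)..1, c t • f (a t • y))
      (∫ t in (0 : ℝ)..1, (c t * a t) • fderiv ℝ f (a t • x)) x := by
  obtain ⟨ρ', h1, h2⟩ := exists_between (mem_ball_zero_iff.1 hx)
  have hmem : ∀ t ∈ Icc (0 : ℝ) 1, ∀ y ∈ Metric.ball (0 : E) ρ', a t • y ∈ Metric.ball 0 ρ' := by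
    intro t ht y hy
    rw [mem_ball_zero_iff] at hy ⊢
    rw [norm_smul]
    exact (mul_le_of_le_one_left (norm_nonneg y) (ha1 t ht)).trans_lt hy
  have hsub : Metric.ball (0 : E) ρ' ⊆ Metric.ball 0 ρ := Metric.ball_subset_ball h2.le
  have hcont : ∀ y ∈ Metric.ball (0 : E) ρ',
      ContinuousOn (fun t => c t • f (a t • y)) (Icc 0 1) := fun y hy =>
    hc.continuousOn.smul (hf.continuousOn.comp (ha.smul continuous_const).continuousOn
      fun t ht => hsub (hmem t ht y hy))
  have hf' : ContinuousOn (fderiv ℝ f) (Metric.ball 0 ρ) :=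
    hf.continuousOn_fderiv_of_isOpen Metric.isOpen_ball (by simp)
  obtain ⟨C, hC⟩ := (isCompact_closedBall (0 : E) ρ').exists_bound_of_continuousOn
    (hf'.mono (Metric.closedBall_subset_ball h2))
  have hx' : x ∈ Metric.ball 0 ρ' := mem_ball_zero_iff.2 h1
  have hI : Ι (0 : ℝ) 1 ⊆ Icc 0 1 := by
    rw [uIoc_of_le zero_le_one]; exact Ioc_subset_Icc_self
  refine intervalIntegral.hasFDerivAt_integral_of_dominated_of_fderiv_le
    (s := Metric.ball 0 ρ') (bound := fun t => |c t * a t| * C)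
    (F := fun y t => c t • f (a t • y)) (F' := fun y t => (c t * a t) • fderiv ℝ f (a t • y))
    (Metric.isOpen_ball.mem_nhds hx') ?_ ?_ ?_ ?_ ?_ ?_
  · filter_upwards [Metric.isOpen_ball.mem_nhds hx'] with y hy
    exact ((hcont y hy).mono hI).aestronglyMeasurable measurableSet_uIoc
  · refine ContinuousOn.intervalIntegrable ?_
    rw [uIcc_of_le zero_le_one]; exact hcont x hx'
  · refine ContinuousOn.aestronglyMeasurable ?_ measurableSet_uIoc
    refine (hc.mul ha).continuousOn.smul (hf'.comp (ha.smul continuous_const).continuousOn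
      fun t ht => hsub (hmem t (hI ht) x hx'))
  · refine Eventually.of_forall fun t ht y hy => ?_
    rw [norm_smul, Real.norm_eq_abs]
    exact mul_le_mul_of_nonneg_left
      (hC _ (Metric.ball_subset_closedBall (hmem t (hI ht) y hy))) (abs_nonneg _)
  · exact ((hc.mul ha).abs.mul continuous_const).intervalIntegrable _ _
  · refine Eventually.of_forall fun t ht y hy => ?_
    have hd : HasFDerivAt f (fderiv ℝ f (a t • y)) (a t • y) :=
      ((hf.contDiffAt (Metric.isOpen_ball.mem_nhds
        (hsub (hmem t (hI ht) y hy)))).differentiableAt (by simp)).hasFDerivAt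
    have h3 := (hd.comp y ((hasFDerivAt_id y).const_smul (a t))).const_smul (c t)
    refine h3.congr_fderiv ?_
    ext v
    simp [mul_smul]

/-- Averages of dilates of a smooth function are smooth. This is the source of every quotient that
has to be smooth across a zero of its denominator. -/
theorem contDiffOn_integral_smul_comp_smul {E F : Type u} [NormedAddCommGroup E]
    [NormedSpace ℝ E] [ProperSpace E] [NormedAddCommGroup F] [NormedSpace ℝ F] {ρ : ℝ} {f : E → F}
    (hf : ContDiffOn ℝ ∞ f (Metric.ball 0 ρ)) {a c : ℝ → ℝ} (ha : Continuous a)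
    (hc : Continuous c) (ha1 : ∀ t ∈ Icc (0 : ℝ) 1, |a t| ≤ 1) :
    ContDiffOn ℝ ∞ (fun x => ∫ t in (0 : ℝ)..1, c t • f (a t • x)) (Metric.ball 0 ρ) := by
  rw [contDiffOn_infty]
  intro m
  induction m generalizing F c with
  | zero =>
    refine contDiffOn_zero.2 fun x hx => ?_
    exact (hasFDerivAt_integral_smul_comp_smul hf ha hc ha1 hx).continuousAt.continuousWithinAt
  | succ m ih =>
    rw [Nat.cast_succ, contDiffOn_succ_iff_fderiv_of_isOpen Metric.isOpen_ball]
    refine ⟨fun x hx => (hasFDerivAt_integral_smul_comp_smul hf ha hc ha1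
      hx).differentiableAt.differentiableWithinAt, by simp, ?_⟩
    refine (ih (hf.fderiv_of_isOpen Metric.isOpen_ball (by simp)) (hc.mul ha)).congr fun x hx => ?_
    exact (hasFDerivAt_integral_smul_comp_smul hf ha hc ha1 hx).fderiv

/-! ### Odd extensions -/

/-- The extension to `ℝ` of the sequence `g` of successive derivatives of a function on `[0, a)`
which makes the extension of `g 0` odd, the extension of `g 1` even, and so on. -/
noncomputable def oddExtension (g : ℕ → ℝ → ℝ) (k : ℕ) (r : ℝ) : ℝ :=
  if 0 ≤ r then g k r else (-1) ^ (k + 1) * g k (-r)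

theorem oddExtension_of_nonpos {g : ℕ → ℝ → ℝ} (h0 : ∀ k, g (2 * k) 0 = 0) (k : ℕ) {r : ℝ}
    (hr : r ≤ 0) : oddExtension g k r = (-1) ^ (k + 1) * g k (-r) := by
  rcases hr.lt_or_eq with hr | rfl
  · simp [oddExtension, hr]
  · rcases Nat.even_or_odd' k with ⟨m, rfl | rfl⟩
    · simp [oddExtension, h0]
    · simp [oddExtension, pow_succ, pow_mul]

/-- At `0` the one-sided derivatives match because the derivatives of even order vanish there. -/
theorem hasDerivAt_oddExtension {g : ℕ → ℝ → ℝ} {a : ℝ}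
    (hg : ∀ k, ∀ r ∈ Ico 0 a, HasDerivWithinAt (g k) (g (k + 1) r) (Ici 0) r)
    (h0 : ∀ k, g (2 * k) 0 = 0) (k : ℕ) {r : ℝ} (hr : r ∈ Ioo (-a) a) :
    HasDerivAt (oddExtension g k) (oddExtension g (k + 1) r) r := by
  have key : ∀ s, s ≤ 0 → -a < s →
      HasDerivWithinAt (oddExtension g k) (oddExtension g (k + 1) s) (Iic 0) s := by
    intro s hs hsa
    have h1 : HasDerivWithinAt (fun t => (-1) ^ (k + 1) * g k (-t))
        ((-1) ^ (k + 1) * (g (k + 1) (-s) * -1)) (Iic 0) s :=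
      ((hg k (-s) ⟨by linarith, by linarith⟩).comp s (hasDerivAt_neg s).hasDerivWithinAt
        (fun t (ht : t ≤ 0) => neg_nonneg.2 ht)).const_mul _
    rw [oddExtension_of_nonpos h0 _ hs]
    refine (h1.congr (fun t ht => oddExtension_of_nonpos h0 k ht)
      (oddExtension_of_nonpos h0 k hs)).congr_deriv ?_
    ring
  have key' : ∀ s, 0 ≤ s → s < a →
      HasDerivWithinAt (oddExtension g k) (oddExtension g (k + 1) s) (Ici 0) s := by
    intro s hs hsa
    have h1 := hg k s ⟨hs, hsa⟩
    rw [show g (k + 1) s = oddExtension g (k + 1) s from by simp [oddExtension, hs] ] at h1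
    exact h1.congr (fun t (ht : 0 ≤ t) => by simp [oddExtension, ht]) (by simp [oddExtension, hs])
  rcases lt_trichotomy r 0 with h | rfl | h
  · exact (key r h.le hr.1).hasDerivAt (Iic_mem_nhds h)
  · have := (key 0 le_rfl hr.1).union (key' 0 le_rfl hr.2)
    rwa [Iic_union_Ici, hasDerivWithinAt_univ] at this
  · exact (key' r h.le hr.2).hasDerivAt (Ici_mem_nhds h)

theorem contDiffOn_oddExtension {g : ℕ → ℝ → ℝ} {a : ℝ}
    (hg : ∀ k, ∀ r ∈ Ico 0 a, HasDerivWithinAt (g k) (g (k + 1) r) (Ici 0) r)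
    (h0 : ∀ k, g (2 * k) 0 = 0) (k : ℕ) : ContDiffOn ℝ ∞ (oddExtension g k) (Ioo (-a) a) := by
  rw [contDiffOn_infty]
  intro m
  induction m generalizing k with
  | zero =>
    exact contDiffOn_zero.2 fun r hr =>
      (hasDerivAt_oddExtension hg h0 k hr).continuousAt.continuousWithinAt
  | succ m ih =>
    rw [Nat.cast_succ, contDiffOn_succ_iff_deriv_of_isOpen isOpen_Ioo]
    refine ⟨fun r hr => (hasDerivAt_oddExtension hg h0 k
      hr).differentiableAt.differentiableWithinAt, by simp, ?_⟩
    exact (ih (k + 1)).congr fun r hr => (hasDerivAt_oddExtension hg h0 k hr).deriv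

/-! ### Radial functions -/

theorem hasFDerivAt_norm_of_ne_zero {E : Type*} [NormedAddCommGroup E] [InnerProductSpace ℝ E]
    {x : E} (hx : x ≠ 0) : HasFDerivAt (fun y : E => ‖y‖) (‖x‖⁻¹ • innerSL ℝ x) x := by
  have hx' : ‖x‖ ≠ 0 := norm_ne_zero_iff.2 hx
  have h := (hasStrictFDerivAt_norm_sq x).hasFDerivAt.sqrt (by positivity)
  simp only [Real.sqrt_sq (norm_nonneg _)] at h
  refine h.congr_fderiv ?_
  ext v
  simp only [smul_apply, smul_eq_mul, nsmul_eq_mul]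
  field_simp
  simp

/-- If `F' = r G` then the gradient of `F(‖x‖)` is `G(‖x‖) x`, at the origin too. -/
theorem hasFDerivAt_comp_norm {E : Type*} [NormedAddCommGroup E] [InnerProductSpace ℝ E]
    {F G : ℝ → ℝ} {a : ℝ} (hFc : ContinuousOn F (Ico 0 a))
    (hF : ∀ r ∈ Ioo 0 a, HasDerivAt F (r * G r) r)
    (hG : ContinuousOn (fun x : E => G ‖x‖) (Metric.ball 0 a)) {x : E}
    (hx : x ∈ Metric.ball 0 a) :
    HasFDerivAt (fun y : E => F ‖y‖) (G ‖x‖ • innerSL ℝ x) x := by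
  rcases eq_or_ne x 0 with rfl | hx0
  · have h1 : (G ‖(0 : E)‖ • innerSL ℝ (0 : E)) = 0 := by simp
    rw [h1, hasFDerivAt_iff_isLittleO_nhds_zero]
    have ha : 0 < a := by simpa using hx
    have hb : ∀ᶠ y : E in 𝓝 0, |G ‖y‖| < |G 0| + 1 := by
      have := (hG.continuousAt (Metric.isOpen_ball.mem_nhds hx)).abs
      refine this.eventually_lt_const ?_
      simp
    obtain ⟨δ, hδ, hδ'⟩ := Metric.eventually_nhds_iff_ball.1 hb
    refine Asymptotics.IsBigO.trans_isLittleO (g := fun y : E => ‖y‖ ^ 2) ?_ ?_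
    · refine Asymptotics.IsBigO.of_bound (|G 0| + 1) ?_
      filter_upwards [Metric.ball_mem_nhds (0 : E) (lt_min hδ ha)] with y hy
      rw [mem_ball_zero_iff, lt_min_iff] at hy
      rcases eq_or_ne y 0 with rfl | hy0
      · simp
      · have hy' : 0 < ‖y‖ := norm_pos_iff.2 hy0
        obtain ⟨c, hc, hc'⟩ := exists_hasDerivAt_eq_slope F (fun r => r * G r) hy'
          (hFc.mono fun t ht => ⟨ht.1, ht.2.trans_lt hy.2⟩)
          (fun t ht => hF t ⟨ht.1, ht.2.trans hy.2⟩)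
        have h2 : F ‖y‖ - F 0 = c * G c * ‖y‖ := by
          rw [hc', sub_zero, div_mul_cancel₀ _ hy'.ne']
        have h3 : |G c| ≤ |G 0| + 1 := by
          have hcn : ‖(c / ‖y‖) • y‖ = c := by
            rw [norm_smul, Real.norm_of_nonneg (div_nonneg hc.1.le hy'.le)]
            field_simp
          have := hδ' ((c / ‖y‖) • y) (by rw [mem_ball_zero_iff, hcn]; exact hc.2.trans hy.1)
          rw [hcn] at this
          exact this.le
        simp only [zero_add, norm_zero, zero_apply, sub_zero]
        rw [h2, norm_mul, norm_mul, norm_pow, norm_norm, Real.norm_of_nonneg hc.1.le,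
          Real.norm_eq_abs]
        have h4 : c * |G c| ≤ ‖y‖ * (|G 0| + 1) :=
          mul_le_mul hc.2.le h3 (abs_nonneg _) hy'.le
        nlinarith
    · simpa using Asymptotics.isLittleO_norm_pow_id (E' := E) one_lt_two
  · have hx' : 0 < ‖x‖ := norm_pos_iff.2 hx0
    have h := (hF ‖x‖ ⟨hx', mem_ball_zero_iff.1 hx⟩).comp_hasFDerivAt x
      (hasFDerivAt_norm_of_ne_zero hx0)
    refine h.congr_fderiv ?_
    rw [smul_smul]
    congr 1
    field_simp

theorem contDiffOn_comp_norm_succ {E : Type*} [NormedAddCommGroup E] [InnerProductSpace ℝ E]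
    {F G : ℝ → ℝ} {a : ℝ} (hFc : ContinuousOn F (Ico 0 a))
    (hF : ∀ r ∈ Ioo 0 a, HasDerivAt F (r * G r) r) {m : ℕ∞}
    (hG : ContDiffOn ℝ m (fun x : E => G ‖x‖) (Metric.ball 0 a)) :
    ContDiffOn ℝ (m + 1) (fun x : E => F ‖x‖) (Metric.ball 0 a) := by
  have h := fun x hx => hasFDerivAt_comp_norm (E := E) hFc hF hG.continuousOn (x := x) hx
  rw [contDiffOn_succ_iff_fderiv_of_isOpen Metric.isOpen_ball]
  refine ⟨fun x hx => (h x hx).differentiableAt.differentiableWithinAt, by simp, ?_⟩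
  exact (hG.smul (innerSL ℝ (E := E)).contDiff.contDiffOn).congr fun x hx => (h x hx).fderiv

theorem integral_deriv_comp_mul {F F' : ℝ → ℝ} {a : ℝ}
    (hF : ∀ r ∈ Ioo (-a) a, HasDerivAt F (F' r) r) (hF' : ContinuousOn F' (Ioo (-a) a)) {r : ℝ}
    (hr : r ∈ Ioo (-a) a) : r * ∫ t in (0 : ℝ)..1, F' (t * r) = F r - F 0 := by
  have hsub : uIcc 0 r ⊆ Ioo (-a) a := by
    refine ordConnected_Ioo.uIcc_subset ⟨?_, ?_⟩ hr <;> linarith [hr.1, hr.2]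
  simp_rw [mul_comm _ r]
  rw [intervalIntegral.mul_integral_comp_mul_left, mul_zero, mul_one]
  exact intervalIntegral.integral_eq_sub_of_hasDerivAt (fun t ht => hF t (hsub ht))
    (hF'.mono hsub).intervalIntegrable

/-- An even smooth function of the distance to the origin is smooth: by Hadamard's lemma its
derivative is `r G(r)` with `G` even and smooth, so that one can induct on the order of
differentiability. -/
theorem contDiffOn_comp_norm_of_even {E : Type*} [NormedAddCommGroup E] [InnerProductSpace ℝ E]
    {F : ℝ → ℝ} {a : ℝ} (hF : ContDiffOn ℝ ∞ F (Ioo (-a) a)) (heven : ∀ r, F (-r) = F r) :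
    ContDiffOn ℝ ∞ (fun x : E => F ‖x‖) (Metric.ball 0 a) := by
  rw [contDiffOn_infty]
  intro m
  induction m generalizing F with
  | zero =>
    refine contDiffOn_zero.2 (hF.continuousOn.comp continuous_norm.continuousOn fun x hx => ?_)
    rw [mem_ball_zero_iff] at hx
    exact ⟨by linarith [norm_nonneg x], hx⟩
  | succ m ih =>
    have hd : ContDiffOn ℝ ∞ (deriv F) (Ioo (-a) a) := hF.deriv_of_isOpen isOpen_Ioo (by simp)
    have hdd : ContDiffOn ℝ ∞ (deriv (deriv F)) (Ioo (-a) a) :=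
      hd.deriv_of_isOpen isOpen_Ioo (by simp)
    have hodd : ∀ r, deriv F (-r) = -deriv F r := by
      intro r
      have := deriv_comp_neg F r
      rw [funext heven] at this
      linarith
    have heven2 : ∀ r, deriv (deriv F) (-r) = deriv (deriv F) r := by
      intro r
      have := deriv_comp_neg (deriv F) r
      rw [funext hodd, deriv.fun_neg] at this
      linarith
    have hat : ∀ {f : ℝ → ℝ}, ContDiffOn ℝ ∞ f (Ioo (-a) a) → ∀ r ∈ Ioo (-a) a,
        HasDerivAt f (deriv f r) r := fun hf r hr =>
      ((hf.contDiffAt (isOpen_Ioo.mem_nhds hr)).differentiableAt (by simp)).hasDerivAt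
    set G : ℝ → ℝ := fun r => ∫ t in (0 : ℝ)..1, deriv (deriv F) (t * r) with hGdef
    have hball : Metric.ball (0 : ℝ) a = Ioo (-a) a := by simp [Real.ball_eq_Ioo]
    have hG : ContDiffOn ℝ ∞ G (Ioo (-a) a) := by
      have := contDiffOn_integral_smul_comp_smul (E := ℝ) (ρ := a) (f := deriv (deriv F))
        (by rwa [hball]) continuous_id (continuous_const (y := (1 : ℝ)))
        (fun t ht => by simpa [abs_of_nonneg ht.1] using ht.2)
      simpa [hball, hGdef] using this
    have hGe : ∀ r, G (-r) = G r := fun r => by simp only [hGdef, mul_neg, heven2]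
    refine contDiffOn_comp_norm_succ (G := G) (m := m) ?_ (fun r hr => ?_) (ih hG hGe)
    · exact hF.continuousOn.mono fun r hr => ⟨by linarith [hr.1, hr.2], hr.2⟩
    · have hr' : r ∈ Ioo (-a) a := ⟨by linarith [hr.1, hr.2], hr.2⟩
      have h0 : deriv F 0 = 0 := by
        have := hodd 0
        rw [neg_zero] at this
        linarith
      rw [hGdef, integral_deriv_comp_mul (hat hd) hdd.continuousOn hr', h0, sub_zero]
      exact hat hF r hr'

/-! ### Traces of rotationally symmetric forms -/

/-- The differential of `r = ‖x‖` at `x ≠ 0`; its value at `x = 0` is `0`. -/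
noncomputable def radialForm {n : ℕ} (x : Base n) : Base n →L[ℝ] ℝ := ‖x‖⁻¹ • innerSL ℝ x

/-- The tensor `r² dθ²`, the part of the Euclidean metric tangent to the spheres about the pole. -/
noncomputable def angularForm {n : ℕ} (x v w : Base n) : ℝ :=
  inner ℝ v w - radialForm x v * radialForm x w

/-- The two forms are simultaneously diagonal, with eigenvalues `a`, `c` in the radial direction and
`b`, `d` on its orthogonal complement, of dimension `n - 1`. -/
theorem trace_gram_inv_mul_gram {n : ℕ} {x : Base n} (hx : x ≠ 0) {a b c d : ℝ} (ha : a ≠ 0)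
    (hb : b ≠ 0) :
    ((gram fun v w => a * (radialForm x v * radialForm x w) + b * angularForm x v w)⁻¹ *
      gram fun v w => c * (radialForm x v * radialForm x w) + d * angularForm x v w).trace
      = c / a + (n - 1) * (d / b) := by
  set y : Fin n → ℝ := fun i => radialForm x (EuclideanSpace.single i 1) with hy
  set P : Matrix (Fin n) (Fin n) ℝ := Matrix.vecMulVec y y with hP
  have hyi : ∀ i, y i = ‖x‖⁻¹ * x i := fun i => by
    simp [hy, radialForm, EuclideanSpace.inner_single_right]
  have hyy : y ⬝ᵥ y = 1 := by
    have hn : ∑ i, x i * x i = ‖x‖ ^ 2 := by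
      rw [EuclideanSpace.norm_sq_eq]
      exact Finset.sum_congr rfl fun i _ => by rw [Real.norm_eq_abs, sq_abs, sq]
    have hx' : ‖x‖ ≠ 0 := norm_ne_zero_iff.2 hx
    calc y ⬝ᵥ y = ∑ i, ‖x‖⁻¹ ^ 2 * (x i * x i) :=
          Finset.sum_congr rfl fun i _ => by rw [hyi]; ring
      _ = 1 := by rw [← Finset.mul_sum, hn]; field_simp
  have hPP : P * P = P := by
    rw [hP, Matrix.vecMulVec_mul_vecMulVec, hyy, one_smul]
  have hgram : ∀ a b : ℝ,
      gram (fun v w => a * (radialForm x v * radialForm x w) + b * angularForm x v w)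
        = a • P + b • (1 - P) := by
    intro a b
    ext i j
    simp only [gram, angularForm, Matrix.of_apply, Matrix.add_apply, Matrix.smul_apply,
      Matrix.sub_apply, Matrix.vecMulVec_apply, hP, smul_eq_mul, hy, Matrix.one_apply,
      EuclideanSpace.inner_single_left, PiLp.single_apply, map_one, one_mul]
  have hinv : (a • P + b • (1 - P))⁻¹ = a⁻¹ • P + b⁻¹ • (1 - P) := by
    refine Matrix.inv_eq_right_inv ?_
    simp only [add_mul, mul_add, smul_mul_smul_comm, mul_sub, sub_mul, hPP, mul_one, one_mul,
      mul_inv_cancel₀ ha, mul_inv_cancel₀ hb, sub_self, smul_zero]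
    simp
  have htr : P.trace = 1 := by rw [hP, Matrix.trace_vecMulVec, hyy]
  rw [hgram, hgram, hinv]
  simp only [add_mul, mul_add, smul_mul_smul_comm, mul_sub, sub_mul, hPP, mul_one, one_mul,
      sub_self, smul_zero, Matrix.trace_add, Matrix.trace_smul, Matrix.trace_sub, htr,
      Matrix.trace_one, Matrix.trace_zero, Fintype.card_fin, smul_eq_mul]
  ring

/-! ### The mean curvature of a rotationally symmetric graph away from the axis -/

section

variable {n : ℕ} {x : Base n}

theorem angularForm_comm (v w : Base n) : angularForm x v w = angularForm x w v := by
  rw [angularForm, angularForm, real_inner_comm, mul_comm (radialForm x v)]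

theorem radialForm_unit (hx : x ≠ 0) : radialForm x (‖x‖⁻¹ • x) = 1 := by
  have hx' : ‖x‖ ≠ 0 := norm_ne_zero_iff.2 hx
  simp only [radialForm, smul_apply, innerSL_apply_apply, inner_smul_right,
    real_inner_self_eq_norm_sq, smul_eq_mul]
  field_simp

theorem angularForm_unit (hx : x ≠ 0) (v : Base n) : angularForm x v (‖x‖⁻¹ • x) = 0 := by
  rw [angularForm, radialForm_unit hx, mul_one]
  simp only [radialForm, smul_apply, innerSL_apply_apply, inner_smul_right, smul_eq_mul,
    real_inner_comm, sub_self]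

theorem hasFDerivAt_norm_radialForm (hx : x ≠ 0) :
    HasFDerivAt (fun y : Base n => ‖y‖) (radialForm x) x := hasFDerivAt_norm_of_ne_zero hx

theorem hasFDerivAt_radialForm_apply (hx : x ≠ 0) (b : Base n) :
    HasFDerivAt (fun y => radialForm y b)
      (‖x‖⁻¹ • (innerSL ℝ b - radialForm x b • radialForm x)) x := by
  have hx' : ‖x‖ ≠ 0 := norm_ne_zero_iff.2 hx
  have h1 := (hasDerivAt_inv hx').comp_hasFDerivAt x (hasFDerivAt_norm_radialForm hx)
  have h2 := h1.mul (innerSL ℝ b).hasFDerivAt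
  have h3 : (fun y => radialForm y b)
      = fun y => ((fun z : ℝ => z⁻¹) ∘ fun y : Base n => ‖y‖) y * (innerSL ℝ b) y := by
    ext y
    simp [radialForm, real_inner_comm]
  rw [h3]
  refine h2.congr_fderiv ?_
  ext v
  simp [radialForm, real_inner_comm b x]
  field_simp
  ring

theorem modelMetric_eq (ξ : ℝ → ℝ) (hx : x ≠ 0) (v w : Base n) :
    modelMetric ξ x v w
      = radialForm x v * radialForm x w + (ξ ‖x‖ / ‖x‖) ^ 2 * angularForm x v w := by
  simp only [modelMetric, hx, if_false, angularForm, radialForm, smul_apply, innerSL_apply_apply,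
    smul_eq_mul]
  ring

theorem hasFDerivAt_comp_fst {g : Base n → ℝ} {g' : Base n →L[ℝ] ℝ} (hg : HasFDerivAt g g' x)
    (s : ℝ) : HasFDerivAt (fun q : Ambient n => g q.1)
      (g' ∘SL ContinuousLinearMap.fst ℝ (Base n) ℝ) (x, s) := by
  have hfst : HasFDerivAt (Prod.fst : Ambient n → Base n)
      (ContinuousLinearMap.fst ℝ (Base n) ℝ) (x, s) := hasFDerivAt_fst
  exact HasFDerivAt.comp (x, s) hg hfst

theorem fderiv_ambientMetric {ξ ψ : ℝ → ℝ} {ξ' ψ' : ℝ} (hx : x ≠ 0)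
    (hξ : HasDerivAt ξ ξ' ‖x‖) (hψ : HasDerivAt ψ ψ' ‖x‖) (s : ℝ) (a b c : Ambient n) :
    fderiv ℝ (fun q => ambientMetric ξ ψ q b c) (x, s) a
      = (1 - (ξ ‖x‖ / ‖x‖) ^ 2) / ‖x‖ * (angularForm x a.1 b.1 * radialForm x c.1
            + angularForm x a.1 c.1 * radialForm x b.1)
        + 2 * (ξ ‖x‖ / ‖x‖) * ((ξ' - ξ ‖x‖ / ‖x‖) / ‖x‖) * radialForm x a.1
            * angularForm x b.1 c.1
        - 2 * ψ' * Real.exp (-2 * ψ ‖x‖) * radialForm x a.1 * (b.2 * c.2) := by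
  have hx' : ‖x‖ ≠ 0 := norm_ne_zero_iff.2 hx
  have hn := hasFDerivAt_norm_radialForm hx
  have hρ := (hξ.div (hasDerivAt_id ‖x‖) hx').comp_hasFDerivAt x hn
  have hb := hasFDerivAt_radialForm_apply hx b.1
  have hc := hasFDerivAt_radialForm_apply hx c.1
  have hm : HasFDerivAt (fun q => modelMetric ξ q b.1 c.1) _ x :=
    ((hb.mul hc).add ((hρ.pow 2).mul ((hb.mul hc).const_sub
      (inner ℝ b.1 c.1)))).congr_of_eventuallyEq (by
      filter_upwards [isOpen_ne.mem_nhds hx] with q hq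
      rw [modelMetric_eq ξ hq]
      rfl)
  have he := ((hψ.const_mul (-2)).exp.comp_hasFDerivAt x hn).mul_const (b.2 * c.2)
  refine (congrArg (fun L => L a) (hasFDerivAt_comp_fst (hm.add he) s).fderiv).trans ?_
  simp only [angularForm, ContinuousLinearMap.comp_apply, add_apply, smul_apply, smul_eq_mul,
    ContinuousLinearMap.coe_fst', sub_apply, neg_apply, innerSL_apply_apply, Function.comp_apply,
    Pi.div_apply, Pi.mul_apply, id, real_inner_comm a.1, nsmul_eq_mul, Nat.add_one_sub_one,
    Nat.cast_ofNat, pow_one]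
  field_simp
  ring

theorem christoffel_ambientMetric {ξ ψ : ℝ → ℝ} {ξ' ψ' : ℝ} (hx : x ≠ 0)
    (hξ : HasDerivAt ξ ξ' ‖x‖) (hψ : HasDerivAt ψ ψ' ‖x‖) (s : ℝ) (a b c : Ambient n) :
    christoffel (ambientMetric ξ ψ) (x, s) a b c
      = (1 - (ξ ‖x‖ / ‖x‖) ^ 2) / ‖x‖ * (angularForm x a.1 b.1 * radialForm x c.1)
        + (ξ ‖x‖ / ‖x‖) * ((ξ' - ξ ‖x‖ / ‖x‖) / ‖x‖) *
          (radialForm x a.1 * angularForm x b.1 c.1 + radialForm x b.1 * angularForm x a.1 c.1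
            - radialForm x c.1 * angularForm x a.1 b.1)
        - ψ' * Real.exp (-2 * ψ ‖x‖) *
          (radialForm x a.1 * (b.2 * c.2) + radialForm x b.1 * (a.2 * c.2)
            - radialForm x c.1 * (a.2 * b.2)) := by
  rw [christoffel, fderiv_ambientMetric hx hξ hψ, fderiv_ambientMetric hx hξ hψ,
    fderiv_ambientMetric hx hξ hψ, angularForm_comm b.1 a.1, angularForm_comm c.1 a.1,
    angularForm_comm c.1 b.1]
  ring

theorem fderiv_graphMap {f : Base n → ℝ} {f' : Base n →L[ℝ] ℝ} (hf : HasFDerivAt f f' x)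
    (v : Base n) : fderiv ℝ (graphMap f) x v = (v, f' v) := by
  have h : HasFDerivAt (graphMap f) ((ContinuousLinearMap.id ℝ (Base n)).prod f') x :=
    (hasFDerivAt_id x).prodMk hf
  rw [h.fderiv]
  rfl

/-- The weighted mean curvature of the graph of a function `f` with `df = p(r) dr`, where `-ν p` is
the radial component of the unit normal. The two terms multiplied by `ν` are the curvature of the
profile curve and the contribution of the `n - 1` rotational directions. -/
theorem hasWeightedMeanCurvatureAt_of_ne_zero {ξ ψ p : ℝ → ℝ} {ξ' ψ' p' ν : ℝ} {f : Base n → ℝ}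
    (hx : x ≠ 0) (hξ : HasDerivAt ξ ξ' ‖x‖) (hξ0 : ξ ‖x‖ ≠ 0) (hψ : HasDerivAt ψ ψ' ‖x‖)
    (hp : HasDerivAt p p' ‖x‖) (hf : ∀ᶠ y in 𝓝 x, HasFDerivAt f (p ‖y‖ • radialForm y) y)
    (hν : 0 < ν) (hν1 : ν ^ 2 * (p ‖x‖ ^ 2 + Real.exp (2 * ψ ‖x‖)) = 1) :
    HasWeightedMeanCurvatureAt ξ ψ f x
      ((ν * ((p' - 2 * ψ' * p ‖x‖ - ψ' * Real.exp (-2 * ψ ‖x‖) * p ‖x‖ ^ 3)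
          / (1 + Real.exp (-2 * ψ ‖x‖) * p ‖x‖ ^ 2) + (n - 1) * (p ‖x‖ * ξ' / ξ ‖x‖))
        - ψ' * ν * p ‖x‖) / n) := by
  have hx' : ‖x‖ ≠ 0 := norm_ne_zero_iff.2 hx
  have hee : Real.exp (-2 * ψ ‖x‖) * Real.exp (2 * ψ ‖x‖) = 1 := by
    rw [← Real.exp_add]; simp
  set e : Base n := ‖x‖⁻¹ • x with he
  have hre : radialForm x e = 1 := radialForm_unit hx
  have hae : ∀ v, angularForm x v e = 0 := angularForm_unit hx
  -- The upward unit normal is `ν (e^{2ψ} ∂_s - ∇f)`.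
  set N : Ambient n := (-(ν * p ‖x‖) • e, ν * Real.exp (2 * ψ ‖x‖)) with hN
  have hrN : radialForm x N.1 = -(ν * p ‖x‖) := by simp [hN, hre]
  have haN : ∀ v, angularForm x v N.1 = 0 := by
    intro v
    have := hae v
    simp only [angularForm, hN, map_smul, inner_smul_right, smul_eq_mul] at this ⊢
    linear_combination (-(ν * p ‖x‖)) * this
  have hdX : ∀ v, fderiv ℝ (graphMap f) x v = (v, p ‖x‖ * radialForm x v) := fun v =>
    fderiv_graphMap hf.self_of_nhds v
  have hmet : ∀ v w, ambientMetric ξ ψ (graphMap f x) v w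
      = radialForm x v.1 * radialForm x w.1 + (ξ ‖x‖ / ‖x‖) ^ 2 * angularForm x v.1 w.1
        + Real.exp (-2 * ψ ‖x‖) * (v.2 * w.2) := fun v w => by
    rw [ambientMetric, graphMap, modelMetric_eq ξ hx]
  have hd2 : ∀ v w, fderiv ℝ (fun y => fderiv ℝ (graphMap f) y w) x v
      = (0, p' * (radialForm x v * radialForm x w) + p ‖x‖ / ‖x‖ * angularForm x v w) := by
    intro v w
    have h1 : (fun y => fderiv ℝ (graphMap f) y w)
        =ᶠ[𝓝 x] fun y => (w, p ‖y‖ * radialForm y w) := by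
      filter_upwards [hf] with y hy
      exact fderiv_graphMap hy w
    have h2 := (hasFDerivAt_const w x).prodMk
      ((hp.comp_hasFDerivAt x (hasFDerivAt_norm_radialForm hx)).mul
        (hasFDerivAt_radialForm_apply hx w))
    have h3 := (h2.congr_of_eventuallyEq h1).fderiv
    rw [h3]
    refine Prod.ext ?_ ?_
    · simp
    · simp [angularForm, real_inner_comm v w]
      ring
  have hfirst : firstForm (ambientMetric ξ ψ) (graphMap f) x = fun v w =>
      (1 + Real.exp (-2 * ψ ‖x‖) * p ‖x‖ ^ 2) * (radialForm x v * radialForm x w)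
        + (ξ ‖x‖ / ‖x‖) ^ 2 * angularForm x v w := by
    ext v w
    rw [firstForm, hmet, hdX, hdX]
    ring
  have hsecond : secondForm (ambientMetric ξ ψ) (graphMap f) N x = fun v w =>
      (ν * (p' - 2 * ψ' * p ‖x‖ - ψ' * Real.exp (-2 * ψ ‖x‖) * p ‖x‖ ^ 3))
          * (radialForm x v * radialForm x w)
        + (ν * p ‖x‖ * (ξ ‖x‖ / ‖x‖) * (ξ' / ‖x‖)) * angularForm x v w := by
    ext v w
    rw [secondForm, hmet, hd2, hdX, hdX, graphMap, christoffel_ambientMetric hx hξ hψ, hrN, haN,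
      haN, haN]
    simp only [hN, map_zero]
    generalize Real.exp (-2 * ψ ‖x‖) = E at hee ⊢
    field_simp
    linear_combination (ν * p' * ‖x‖ ^ 3 * radialForm x v * radialForm x w + ν * p ‖x‖ * ‖x‖ ^ 2
      * angularForm x v w - 2 * ψ' * ν * p ‖x‖ * ‖x‖ ^ 3 * radialForm x v * radialForm x w) * hee
  refine ⟨N, ⟨fun v => ?_, ?_, ?_⟩, ?_⟩
  · rw [hmet, hdX, angularForm_comm, haN, hrN]
    simp only [hN]
    linear_combination (ν * p ‖x‖ * radialForm x v) * hee
  · rw [hmet, haN, hrN]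
    simp only [hN]
    linear_combination hν1 + (ν ^ 2 * Real.exp (2 * ψ ‖x‖)) * hee
  · rw [hmet, angularForm_comm, haN, hrN]
    simp only [hN, map_zero]
    have : Real.exp (-2 * ψ ‖x‖) * (ν * Real.exp (2 * ψ ‖x‖) * 1) = ν := by
      linear_combination ν * hee
    linarith
  · have h1 : 1 + Real.exp (-2 * ψ ‖x‖) * p ‖x‖ ^ 2 ≠ 0 := by positivity
    have h2 : (ξ ‖x‖ / ‖x‖) ^ 2 ≠ 0 := by positivity
    have h3 := hasFDerivAt_comp_fst
      (hψ.comp_hasFDerivAt x (hasFDerivAt_norm_radialForm hx)) (f x)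
    rw [meanCurvature, hfirst, hsecond, trace_gram_inv_mul_gram hx h1 h2, graphMap,
      show (fun q : Ambient n => ψ ‖q.1‖) = fun q => (ψ ∘ norm) q.1 from rfl, h3.fderiv]
    simp only [ContinuousLinearMap.comp_apply, smul_apply, ContinuousLinearMap.coe_fst', hrN,
      smul_eq_mul]
    field_simp
    ring

end

/-! ### The mean curvature of a rotationally symmetric graph on the axis -/

section

variable {n : ℕ}

/-- A radial function is even, so that its derivative at the origin vanishes if it exists. -/
theorem hasFDerivAt_comp_norm_zero {E : Type*} [NormedAddCommGroup E] [NormedSpace ℝ E]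
    {F : ℝ → ℝ} (hF : DifferentiableAt ℝ (fun x : E => F ‖x‖) 0) :
    HasFDerivAt (fun x : E => F ‖x‖) (0 : E →L[ℝ] ℝ) 0 := by
  have h1 := hF.hasFDerivAt
  have h2 : HasFDerivAt (fun x : E => F ‖x‖)
      (fderiv ℝ (fun x : E => F ‖x‖) 0 ∘SL (-ContinuousLinearMap.id ℝ E)) 0 := by
    have h3 : HasFDerivAt (fun x : E => F ‖x‖) (fderiv ℝ (fun x : E => F ‖x‖) 0) (-0) := by
      rwa [neg_zero]
    have h4 := h3.comp (0 : E) (hasFDerivAt_id (0 : E)).neg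
    exact h4.congr_of_eventuallyEq (Eventually.of_forall fun x => by simp)
  have h5 : fderiv ℝ (fun x : E => F ‖x‖) 0 = 0 := by
    have := h1.unique h2
    ext v
    have h6 := DFunLike.congr_fun this v
    simp only [ContinuousLinearMap.comp_apply, neg_apply, ContinuousLinearMap.id_apply,
      map_neg] at h6
    simp only [zero_apply]
    linarith
  rwa [h5] at h1

/-- The metric of the model space is Euclidean to first order at the pole: it is
`η² ⟨v, w⟩ + (1 - η²) dr(v) dr(w)` with `η = ξ / r`, and `1 - η²` vanishes to first order. -/
theorem hasFDerivAt_modelMetric_zero {ξ η : ℝ → ℝ}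
    (hη : DifferentiableAt ℝ (fun x : Base n => η ‖x‖) 0) (hη0 : η 0 = 1)
    (hξη : ∀ᶠ x : Base n in 𝓝 0, ξ ‖x‖ = ‖x‖ * η ‖x‖) (b c : Base n) :
    HasFDerivAt (fun q => modelMetric ξ q b c) (0 : Base n →L[ℝ] ℝ) 0 := by
  have h1 : HasFDerivAt (fun x : Base n => η ‖x‖ ^ 2) (0 : Base n →L[ℝ] ℝ) 0 :=
    hasFDerivAt_comp_norm_zero (F := fun r => η r ^ 2) (hη.pow 2)
  have h2 : HasFDerivAt
      (fun q : Base n => (1 - η ‖q‖ ^ 2) * (radialForm q b * radialForm q c))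
      (0 : Base n →L[ℝ] ℝ) 0 := by
    have h3 := h1.const_sub 1
    rw [neg_zero, hasFDerivAt_iff_isLittleO_nhds_zero] at h3
    rw [hasFDerivAt_iff_isLittleO_nhds_zero]
    have hbd : ∀ q d : Base n, ‖radialForm q d‖ ≤ ‖d‖ := by
      intro q d
      rcases eq_or_ne q 0 with rfl | hq
      · simp [radialForm]
      · have hq' : 0 < ‖q‖ := norm_pos_iff.2 hq
        rw [radialForm, smul_apply, norm_smul, norm_inv, norm_norm, inv_mul_le_iff₀ hq']
        exact norm_inner_le_norm q d
    have h4 : (fun q : Base n => radialForm q b * radialForm q c) =O[𝓝 0]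
        fun _ => (1 : ℝ) := by
      refine Asymptotics.IsBigO.of_bound (‖b‖ * ‖c‖) (Eventually.of_forall fun q => ?_)
      rw [norm_mul, norm_one, mul_one]
      exact mul_le_mul (hbd q b) (hbd q c) (norm_nonneg _) (norm_nonneg _)
    have h5 := h3.norm_right.mul_isBigO h4
    simp only [mul_one] at h5
    simpa [hη0, radialForm] using h5.of_norm_right
  have h5 := (h1.mul_const (inner ℝ b c)).add h2
  rw [smul_zero, add_zero] at h5
  refine h5.congr_of_eventuallyEq ?_
  filter_upwards [hξη] with q hq
  rcases eq_or_ne q 0 with rfl | hq0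
  · simp [modelMetric, hη0]
  · have hq' : ‖q‖ ≠ 0 := norm_ne_zero_iff.2 hq0
    rw [modelMetric_eq ξ hq0, hq, mul_div_cancel_left₀ _ hq', angularForm]
    simp only [Pi.add_apply]
    ring

theorem fderiv_ambientMetric_zero {ξ η ψ : ℝ → ℝ}
    (hη : DifferentiableAt ℝ (fun x : Base n => η ‖x‖) 0) (hη0 : η 0 = 1)
    (hξη : ∀ᶠ x : Base n in 𝓝 0, ξ ‖x‖ = ‖x‖ * η ‖x‖)
    (hψ : DifferentiableAt ℝ (fun x : Base n => ψ ‖x‖) 0) (s : ℝ) (b c : Ambient n) :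
    fderiv ℝ (fun q => ambientMetric ξ ψ q b c) (0, s) = 0 := by
  have he : HasFDerivAt (fun x : Base n => Real.exp (-2 * ψ ‖x‖)) (0 : Base n →L[ℝ] ℝ) 0 :=
    hasFDerivAt_comp_norm_zero (F := fun r => Real.exp (-2 * ψ r)) (hψ.const_mul (-2)).exp
  have h := hasFDerivAt_comp_fst ((hasFDerivAt_modelMetric_zero hη hη0 hξη b.1 c.1).add
    (he.mul_const (b.2 * c.2))) s
  refine h.fderiv.trans ?_
  simp

/-- Over the pole the tangent plane of the graph of `f`, with `∇f = h(r) x`, is horizontal and the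
Christoffel symbols vanish, so that the mean curvature comes from the Hessian of `f`, which is
`h(0)` times the metric. -/
theorem hasWeightedMeanCurvatureAt_zero (hn : n ≠ 0) {ξ η ψ h : ℝ → ℝ} {f : Base n → ℝ}
    (hη : DifferentiableAt ℝ (fun x : Base n => η ‖x‖) 0) (hη0 : η 0 = 1)
    (hξη : ∀ᶠ x : Base n in 𝓝 0, ξ ‖x‖ = ‖x‖ * η ‖x‖)
    (hψ : DifferentiableAt ℝ (fun x : Base n => ψ ‖x‖) 0)
    (hh : DifferentiableAt ℝ (fun x : Base n => h ‖x‖) 0)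
    (hf : ∀ᶠ y in 𝓝 (0 : Base n), HasFDerivAt f (h ‖y‖ • innerSL ℝ y) y) :
    HasWeightedMeanCurvatureAt ξ ψ f 0 (Real.exp (-ψ 0) * h 0) := by
  have hee : Real.exp (-2 * ψ 0) * Real.exp (ψ 0) = Real.exp (-ψ 0) := by
    rw [← Real.exp_add]; congr 1; ring
  have hee' : Real.exp (-ψ 0) * Real.exp (ψ 0) = 1 := by
    rw [← Real.exp_add]; simp
  have hdX : ∀ v, fderiv ℝ (graphMap f) 0 v = (v, 0) := fun v => by
    rw [fderiv_graphMap hf.self_of_nhds v]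
    simp
  have hmet : ∀ v w, ambientMetric ξ ψ (graphMap f 0) v w
      = inner ℝ v.1 w.1 + Real.exp (-2 * ψ 0) * (v.2 * w.2) := fun v w => by
    simp [ambientMetric, graphMap, modelMetric]
  have hd2 : ∀ v w, fderiv ℝ (fun y => fderiv ℝ (graphMap f) y w) 0 v
      = (0, h 0 * inner ℝ v w) := by
    intro v w
    have h1 : (fun y => fderiv ℝ (graphMap f) y w)
        =ᶠ[𝓝 0] fun y => (w, h ‖y‖ * innerSL ℝ w y) := by
      filter_upwards [hf] with y hy
      rw [fderiv_graphMap hy w]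
      simp [real_inner_comm]
    have h2 := (hasFDerivAt_const w (0 : Base n)).prodMk
      (hh.hasFDerivAt.mul (innerSL ℝ w).hasFDerivAt)
    rw [(h2.congr_of_eventuallyEq h1).fderiv]
    simp [real_inner_comm]
  have hchr : ∀ a b c, christoffel (ambientMetric ξ ψ) (graphMap f 0) a b c = 0 := by
    intro a b c
    simp only [christoffel, graphMap, fderiv_ambientMetric_zero hη hη0 hξη hψ, zero_apply]
    simp
  set N : Ambient n := (0, Real.exp (ψ 0)) with hN
  have hgram : ∀ c : ℝ, gram (fun v w : Base n => c * inner ℝ v w) = c • 1 := by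
    intro c
    ext i j
    simp only [gram, Matrix.of_apply, Matrix.smul_apply, Matrix.one_apply, smul_eq_mul,
      EuclideanSpace.inner_single_left, PiLp.single_apply, map_one, one_mul]
  have hfirst : firstForm (ambientMetric ξ ψ) (graphMap f) 0
      = fun v w : Base n => 1 * inner ℝ v w := by
    ext v w
    rw [firstForm, hmet, hdX, hdX]
    simp
  have hsecond : secondForm (ambientMetric ξ ψ) (graphMap f) N 0
      = fun v w : Base n => (Real.exp (-ψ 0) * h 0) * inner ℝ v w := by
    ext v w
    rw [secondForm, hmet, hd2, hchr]
    simp only [hN, inner_zero_left, zero_add, add_zero]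
    linear_combination (h 0 * inner ℝ v w) * hee
  refine ⟨N, ⟨fun v => ?_, ?_, ?_⟩, ?_⟩
  · rw [hmet, hdX]
    simp [hN]
  · rw [hmet]
    simp only [hN, inner_zero_left, zero_add]
    linear_combination Real.exp (ψ 0) * hee + hee'
  · rw [hmet]
    simp only [hN, inner_zero_left, zero_add, mul_one, hee]
    positivity
  · have hn' : (n : ℝ) ≠ 0 := Nat.cast_ne_zero.2 hn
    have h3 : fderiv ℝ (fun q : Ambient n => ψ ‖q.1‖) (0, f 0) = 0 := by
      have h4 := hasFDerivAt_comp_fst (hasFDerivAt_comp_norm_zero hψ) (f 0)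
      rw [ContinuousLinearMap.zero_comp] at h4
      exact h4.fderiv
    rw [meanCurvature, hfirst, hsecond, hgram, hgram, graphMap, h3]
    simp
    field_simp

end

/-! ### Smooth radial coefficients of the model -/

theorem contDiffOn_Ioo_of_comp_norm {n : ℕ} (hn : n ≠ 0) {F : ℝ → ℝ} {a : ℝ}
    (hF : ContDiffOn ℝ ∞ (fun x : Base n => F ‖x‖) (Metric.ball 0 a)) :
    ContDiffOn ℝ ∞ F (Ioo 0 a) ∧ ContinuousOn F (Ico 0 a) := by
  set e : Base n := EuclideanSpace.single ⟨0, Nat.pos_of_ne_zero hn⟩ 1 with he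
  have hne : ∀ r : ℝ, 0 ≤ r → ‖r • e‖ = r := fun r hr => by
    simp [norm_smul, he, abs_of_nonneg hr]
  have hmaps : MapsTo (fun r : ℝ => r • e) (Ico 0 a) (Metric.ball 0 a) := fun r hr => by
    rw [mem_ball_zero_iff, hne r hr.1]
    exact hr.2
  have hc : ContDiff ℝ ∞ (fun r : ℝ => r • e) := contDiff_id.smul contDiff_const
  refine ⟨?_, ?_⟩
  · refine (hF.comp hc.contDiffOn (hmaps.mono_left Ioo_subset_Ico_self)).congr fun r hr => ?_
    simp only [Function.comp_apply, hne r hr.1.le]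
  · refine (hF.continuousOn.comp hc.continuous.continuousOn hmaps).congr fun r hr => ?_
    simp only [Function.comp_apply, hne r hr.1]

/-- The regularity of a model space and of a radial weight on the ball of radius `r₁` about the
pole, expressed through the quotient `η = ξ / r`, which is smooth and positive up to the pole. -/
structure IsRegularModel (n : ℕ) (r₁ : ℝ) (ξ η ψ : ℝ → ℝ) : Prop where
  dim_ne_zero : n ≠ 0
  radius_pos : 0 < r₁
  quotient_zero : η 0 = 1
  warping_eq : ∀ r ∈ Ico 0 r₁, ξ r = r * η r
  warping_pos : ∀ r ∈ Ioo 0 r₁, 0 < ξ r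
  smooth_quotient : ContDiffOn ℝ ∞ (fun x : Base n => η ‖x‖) (Metric.ball 0 r₁)
  smooth_weight : ContDiffOn ℝ ∞ (fun x : Base n => ψ ‖x‖) (Metric.ball 0 r₁)

theorem isOpen_coe_lt (R : EReal) : IsOpen {r : ℝ | (r : EReal) < R} :=
  isOpen_lt continuous_coe_real_ereal continuous_const

/-- The conditions on `ξ` at the pole make `ξ / r` a smooth function on the model space: `ξ` has an
odd smooth extension, and `ξ / r` is the average of its derivative over `[0, r]`, which is even. -/
theorem KillingGraph.IsWarpingFunction.exists_isRegularModel {n : ℕ} (hn : n ≠ 0) {R : EReal}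
    {ξ ψ : ℝ → ℝ} (hξ : IsWarpingFunction R ξ)
    (hψ : ContDiffOn ℝ ∞ (fun x : Base n => ψ ‖x‖) (modelBall n R)) {r₁ : ℝ} (hr₁ : 0 < r₁)
    (hr₁R : (r₁ : EReal) < R) : ∃ η, IsRegularModel n r₁ ξ η ψ := by
  set g : ℕ → ℝ → ℝ := fun k => iteratedDerivWithin k ξ (radii R) with hgdef
  have hlt : ∀ {r : ℝ}, r < r₁ → (r : EReal) < R := fun h => (EReal.coe_lt_coe h).trans hr₁R
  have hU : UniqueDiffOn ℝ (radii R) := (uniqueDiffOn_Ici 0).inter (isOpen_coe_lt R)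
  have hg : ∀ k, ∀ r ∈ Ico 0 r₁, HasDerivWithinAt (g k) (g (k + 1) r) (Ici 0) r := by
    intro k r hr
    have h1 : HasDerivWithinAt (g k) (g (k + 1) r) (radii R) r := by
      simp only [hgdef, iteratedDerivWithin_succ]
      exact (hξ.smooth.differentiableOn_iteratedDerivWithin
        (by exact_mod_cast ENat.natCast_lt_top k) hU r ⟨hr.1, hlt hr.2⟩).hasDerivWithinAt
    exact h1.mono_of_mem_nhdsWithin
      (inter_mem_nhdsWithin _ ((isOpen_coe_lt R).mem_nhds (hlt hr.2)))
  have h0 : ∀ k, g (2 * k) 0 = 0 := hξ.even_deriv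
  set η : ℝ → ℝ := fun r => ∫ t in (0 : ℝ)..1, oddExtension g 1 (t * r) with hηdef
  have hball : Metric.ball (0 : ℝ) r₁ = Ioo (-r₁) r₁ := by simp [Real.ball_eq_Ioo]
  have hηs : ContDiffOn ℝ ∞ η (Ioo (-r₁) r₁) := by
    have := contDiffOn_integral_smul_comp_smul (E := ℝ) (ρ := r₁) (f := oddExtension g 1)
      (by rw [hball]; exact contDiffOn_oddExtension hg h0 1) continuous_id
      (continuous_const (y := (1 : ℝ))) (fun t ht => by simpa [abs_of_nonneg ht.1] using ht.2)
    simpa [hball, hηdef] using this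
  have heven : ∀ r, oddExtension g 1 (-r) = oddExtension g 1 r := by
    intro r
    rcases lt_trichotomy r 0 with h | rfl | h
    · simp [oddExtension, h.le, h]
    · simp
    · simp [oddExtension, h.le, h]
  have hξη : ∀ r ∈ Ico 0 r₁, ξ r = r * η r := by
    intro r hr
    rw [hηdef, integral_deriv_comp_mul (F := oddExtension g 0)
      (fun s hs => hasDerivAt_oddExtension hg h0 0 hs)
      (contDiffOn_oddExtension hg h0 1).continuousOn ⟨by linarith [hr.1], hr.2⟩]
    have : ξ 0 = 0 := by simpa [hgdef] using h0 0
    simp [oddExtension, hr.1, this, hgdef]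
  refine ⟨η, hn, hr₁, ?_, hξη, fun r hr => hξ.pos r hr.1 (hlt hr.2), ?_, ?_⟩
  · simp [hηdef, oddExtension, hgdef, iteratedDerivWithin_one, hξ.deriv_one]
  · exact contDiffOn_comp_norm_of_even hηs fun r => by simp only [hηdef, mul_neg, heven]
  · refine hψ.mono fun x hx => hlt (mem_ball_zero_iff.1 hx)

/-- The density `e^{-2ψ} (ξ / r)^{n-1}` of the weighted volume with respect to Lebesgue measure. -/
noncomputable def volumeDensity (n : ℕ) (η ψ : ℝ → ℝ) (r : ℝ) : ℝ :=
  Real.exp (-2 * ψ r) * η r ^ (n - 1)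

/-- The quotient `V_ψ(r) / r^n`, written so that it makes sense at `r = 0`. -/
noncomputable def volumeQuotient (n : ℕ) (η ψ : ℝ → ℝ) (r : ℝ) : ℝ :=
  ∫ t in (0 : ℝ)..1, t ^ (n - 1) * volumeDensity n η ψ (t * r)

namespace IsRegularModel

variable {n : ℕ} {r₁ : ℝ} {ξ η ψ : ℝ → ℝ}

theorem quotient_pos (h : IsRegularModel n r₁ ξ η ψ) {r : ℝ} (hr : r ∈ Ico 0 r₁) : 0 < η r := by
  rcases hr.1.eq_or_lt with rfl | h0
  · rw [h.quotient_zero]; exact one_pos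
  · have := h.warping_pos r ⟨h0, hr.2⟩
    rw [h.warping_eq r hr] at this
    exact (pos_iff_pos_of_mul_pos this).1 h0

theorem smooth_volumeDensity (h : IsRegularModel n r₁ ξ η ψ) :
    ContDiffOn ℝ ∞ (fun x : Base n => volumeDensity n η ψ ‖x‖) (Metric.ball 0 r₁) :=
  (contDiffOn_const.mul h.smooth_weight).exp.mul (h.smooth_quotient.pow (n - 1))

theorem volumeDensity_pos (h : IsRegularModel n r₁ ξ η ψ) {r : ℝ} (hr : r ∈ Ico 0 r₁) :
    0 < volumeDensity n η ψ r :=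
  mul_pos (Real.exp_pos _) (pow_pos (h.quotient_pos hr) _)

theorem weightedArea_eq (h : IsRegularModel n r₁ ξ η ψ) {r : ℝ} (hr : r ∈ Ico 0 r₁) :
    weightedArea n ξ ψ r = r ^ (n - 1) * volumeDensity n η ψ r := by
  rw [weightedArea, volumeDensity, h.warping_eq r hr, mul_pow]
  ring

theorem weightedArea_pos (h : IsRegularModel n r₁ ξ η ψ) {r : ℝ} (hr : r ∈ Ioo 0 r₁) :
    0 < weightedArea n ξ ψ r :=
  mul_pos (Real.exp_pos _) (pow_pos (h.warping_pos r hr) _)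

theorem continuousOn_weightedArea (h : IsRegularModel n r₁ ξ η ψ) :
    ContinuousOn (weightedArea n ξ ψ) (Ico 0 r₁) :=
  ((continuous_pow _).continuousOn.mul
    (contDiffOn_Ioo_of_comp_norm h.dim_ne_zero h.smooth_volumeDensity).2).congr
    fun _ hr => h.weightedArea_eq hr

theorem contDiffOn_weightedArea (h : IsRegularModel n r₁ ξ η ψ) :
    ContDiffOn ℝ ∞ (weightedArea n ξ ψ) (Ioo 0 r₁) :=
  ((contDiff_id.pow _).contDiffOn.mul
    (contDiffOn_Ioo_of_comp_norm h.dim_ne_zero h.smooth_volumeDensity).1).congr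
    fun _ hr => h.weightedArea_eq (Ioo_subset_Ico_self hr)

theorem smooth_volumeQuotient (h : IsRegularModel n r₁ ξ η ψ) :
    ContDiffOn ℝ ∞ (fun x : Base n => volumeQuotient n η ψ ‖x‖) (Metric.ball 0 r₁) := by
  refine (contDiffOn_integral_smul_comp_smul h.smooth_volumeDensity continuous_id
    (continuous_pow (n - 1))
    (fun t ht => by simpa [abs_of_nonneg ht.1] using ht.2)).congr fun x _ => ?_
  refine intervalIntegral.integral_congr fun t ht => ?_
  rw [uIcc_of_le zero_le_one] at ht
  simp [norm_smul, abs_of_nonneg ht.1]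

theorem volumeQuotient_zero (h : IsRegularModel n r₁ ξ η ψ) :
    n * volumeQuotient n η ψ 0 = Real.exp (-2 * ψ 0) := by
  have hn : (n : ℝ) ≠ 0 := Nat.cast_ne_zero.2 h.dim_ne_zero
  have hn1 : ((n - 1 : ℕ) : ℝ) + 1 = n := by
    rw [Nat.cast_sub (Nat.one_le_iff_ne_zero.2 h.dim_ne_zero)]; simp
  simp only [volumeQuotient, mul_zero, intervalIntegral.integral_mul_const, integral_pow, hn1,
    volumeDensity, h.quotient_zero]
  simp
  field_simp

theorem weightedVolume_eq (h : IsRegularModel n r₁ ξ η ψ) {r : ℝ} (hr : r ∈ Ico 0 r₁) :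
    weightedVolume n ξ ψ r = r ^ n * volumeQuotient n η ψ r := by
  have h1 := intervalIntegral.mul_integral_comp_mul_left (a := 0) (b := 1)
    (f := weightedArea n ξ ψ) r
  rw [mul_zero, mul_one] at h1
  have h2 : ∫ t in (0 : ℝ)..1, weightedArea n ξ ψ (r * t)
      = r ^ (n - 1) * volumeQuotient n η ψ r := by
    rw [volumeQuotient, ← intervalIntegral.integral_const_mul]
    refine intervalIntegral.integral_congr fun t ht => ?_
    rw [uIcc_of_le zero_le_one] at ht
    have hrt : r * t ∈ Ico 0 r₁ := ⟨mul_nonneg hr.1 ht.1,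
      (mul_le_of_le_one_right hr.1 ht.2).trans_lt hr.2⟩
    simp only [h.weightedArea_eq hrt, mul_pow, mul_comm t r]
    ring
  rw [weightedVolume, ← h1, h2, ← mul_assoc, mul_pow_sub_one h.dim_ne_zero]

theorem contDiffOn_weightedVolume (h : IsRegularModel n r₁ ξ η ψ) :
    ContDiffOn ℝ ∞ (weightedVolume n ξ ψ) (Ioo 0 r₁) :=
  ((contDiff_id.pow _).contDiffOn.mul
    (contDiffOn_Ioo_of_comp_norm h.dim_ne_zero h.smooth_volumeQuotient).1).congr
    fun _ hr => h.weightedVolume_eq (Ioo_subset_Ico_self hr)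

theorem intervalIntegrable_weightedArea (h : IsRegularModel n r₁ ξ η ψ) {r : ℝ}
    (hr : r ∈ Ico 0 r₁) : IntervalIntegrable (weightedArea n ξ ψ) volume 0 r := by
  refine (h.continuousOn_weightedArea.mono fun t ht => ?_).intervalIntegrable
  rw [uIcc_of_le hr.1] at ht
  exact ⟨ht.1, ht.2.trans_lt hr.2⟩

theorem weightedVolume_pos (h : IsRegularModel n r₁ ξ η ψ) {r : ℝ} (hr : r ∈ Ioo 0 r₁) :
    0 < weightedVolume n ξ ψ r :=
  intervalIntegral.intervalIntegral_pos_of_pos_on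
    (h.intervalIntegrable_weightedArea (Ioo_subset_Ico_self hr))
    (fun _ ht => h.weightedArea_pos ⟨ht.1, ht.2.trans hr.2⟩) hr.1

theorem hasDerivAt_weightedVolume (h : IsRegularModel n r₁ ξ η ψ) {r : ℝ} (hr : r ∈ Ioo 0 r₁) :
    HasDerivAt (weightedVolume n ξ ψ) (weightedArea n ξ ψ r) r := by
  have hc : ContinuousOn (weightedArea n ξ ψ) (Ioo 0 r₁) :=
    h.continuousOn_weightedArea.mono Ioo_subset_Ico_self
  exact intervalIntegral.integral_hasDerivAt_right
    (h.intervalIntegrable_weightedArea (Ioo_subset_Ico_self hr))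
    (hc.stronglyMeasurableAtFilter isOpen_Ioo r hr) (hc.continuousAt (isOpen_Ioo.mem_nhds hr))

theorem hasDerivAt_weightedArea (h : IsRegularModel n r₁ ξ η ψ) {r ξ' ψ' : ℝ}
    (hr : r ∈ Ioo 0 r₁) (hξ : HasDerivAt ξ ξ' r) (hψ : HasDerivAt ψ ψ' r) :
    HasDerivAt (weightedArea n ξ ψ)
      (weightedArea n ξ ψ r * ((n - 1) * ξ' / ξ r - 2 * ψ')) r := by
  have h0 := (h.warping_pos r hr).ne'
  refine ((hψ.const_mul (-2)).exp.mul (hξ.pow (n - 1))).congr_deriv ?_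
  obtain ⟨m, rfl⟩ := Nat.exists_eq_succ_of_ne_zero h.dim_ne_zero
  simp only [weightedArea, Nat.succ_eq_add_one, Nat.add_sub_cancel, Pi.pow_apply]
  rcases m with _ | m
  · simp
  · simp only [Nat.add_sub_cancel]
    push_cast
    field_simp
    ring

end IsRegularModel

theorem flux_eq (n : ℕ) (ξ ψ : ℝ → ℝ) (H₀ r : ℝ) :
    flux n ξ ψ H₀ r = n * H₀ * weightedVolume n ξ ψ r := by
  rw [flux, weightedVolume, ← intervalIntegral.integral_const_mul]
  simp only [weightedArea, mul_assoc]

theorem radialSlope_eq (n : ℕ) (ξ ψ : ℝ → ℝ) (H₀ r : ℝ) :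
    radialSlope n ξ ψ H₀ r = Real.exp (ψ r) * (flux n ξ ψ H₀ r
      / √(weightedArea n ξ ψ r ^ 2 - flux n ξ ψ H₀ r ^ 2)) := by
  have : Real.exp (-4 * ψ r) * ξ r ^ (2 * (n - 1)) = weightedArea n ξ ψ r ^ 2 := by
    rw [weightedArea, mul_pow, ← Real.exp_nat_mul, ← pow_mul, mul_comm (n - 1)]
    congr 2
    push_cast
    ring
  rw [radialSlope, this]

/-! ### Integrands with an inverse square root singularity -/

/-- Hadamard's lemma on an interval: the quotient of a smooth function by `r - c` is smooth across a
zero at `c`. -/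
theorem exists_contDiffOn_eq_sub_mul {f : ℝ → ℝ} {c δ : ℝ}
    (hf : ContDiffOn ℝ ∞ f (Ioo (c - δ) (c + δ))) (hc : f c = 0) :
    ∃ E : ℝ → ℝ, ContDiffOn ℝ ∞ E (Ioo (c - δ) (c + δ)) ∧
      (∀ r ∈ Ioo (c - δ) (c + δ), f r = (r - c) * E r) ∧ E c = deriv f c := by
  have hball : Metric.ball (0 : ℝ) δ = Ioo (-δ) δ := by simp [Real.ball_eq_Ioo]
  have hshift : MapsTo (fun z : ℝ => c + z) (Ioo (-δ) δ) (Ioo (c - δ) (c + δ)) := fun z hz =>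
    ⟨by linarith [hz.1], by linarith [hz.2]⟩
  have hunshift : MapsTo (fun r : ℝ => r - c) (Ioo (c - δ) (c + δ)) (Ioo (-δ) δ) := fun z hz =>
    ⟨by linarith [hz.1], by linarith [hz.2]⟩
  have hf' : ContDiffOn ℝ ∞ (fun z => deriv f (c + z)) (Ioo (-δ) δ) :=
    (hf.deriv_of_isOpen isOpen_Ioo (by simp)).comp (contDiff_const.add contDiff_id).contDiffOn
      hshift
  have h1 : ContDiffOn ℝ ∞ (fun z => ∫ t in (0 : ℝ)..1, deriv f (c + t * z)) (Ioo (-δ) δ) := by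
    have := contDiffOn_integral_smul_comp_smul (E := ℝ) (ρ := δ) (f := fun z => deriv f (c + z))
      (by rwa [hball]) continuous_id (continuous_const (y := (1 : ℝ)))
      (fun t ht => by simpa [abs_of_nonneg ht.1] using ht.2)
    simpa [hball] using this
  refine ⟨fun r => ∫ t in (0 : ℝ)..1, deriv f (c + t * (r - c)),
    h1.comp (contDiff_id.sub contDiff_const).contDiffOn hunshift, fun r hr => ?_, by simp⟩
  have h2 : ∀ z ∈ Ioo (-δ) δ, HasDerivAt (fun z => f (c + z)) (deriv f (c + z)) z := by
    intro z hz
    have := ((hf.contDiffAt (isOpen_Ioo.mem_nhds (hshift hz))).differentiableAt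
      (by simp)).hasDerivAt
    exact this.comp_const_add c z
  have h3 := integral_deriv_comp_mul h2 hf'.continuousOn (hunshift hr)
  rw [add_zero, hc, sub_zero, add_sub_cancel] at h3
  exact h3.symm

section

variable {κ slope : ℝ → ℝ} {c δ : ℝ}

theorem intervalIntegrable_of_eq_div_sqrt (hκ : ContinuousOn κ (Ioo (c - δ) (c + δ)))
    (hs : ∀ r ∈ Ioo (c - δ) c, slope r = κ r / √(c - r)) {a : ℝ} (ha : a ∈ Ioc (c - δ) c) :
    IntervalIntegrable slope volume a c := by
  have hδ : 0 < δ := by linarith [ha.1, ha.2]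
  have h1 : IntervalIntegrable (fun r => (c - r) ^ (-(1 / 2) : ℝ)) volume a c := by
    have := (intervalIntegral.intervalIntegrable_rpow' (a := c - a) (b := 0)
      (r := -(1 / 2)) (by norm_num)).comp_sub_left c
    simpa using this
  have h2 : IntervalIntegrable (fun r => κ r * (c - r) ^ (-(1 / 2) : ℝ)) volume a c := by
    refine h1.continuousOn_mul (hκ.mono fun t ht => ?_)
    rw [uIcc_of_le ha.2] at ht
    exact ⟨ha.1.trans_le ht.1, by linarith [ht.2]⟩
  refine h2.congr_ae ?_
  rw [uIoc_of_le ha.2, ← restrict_Ioo_eq_restrict_Ioc]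
  filter_upwards [ae_restrict_mem measurableSet_Ioo] with r hr
  rw [hs r ⟨ha.1.trans hr.1, hr.2⟩, Real.rpow_neg (by linarith [hr.2]), Real.sqrt_eq_rpow,
    div_eq_mul_inv (κ r)]

/-- The substitution `τ = c - z²` removes the singularity: the primitive of `κ / √(c - r)` vanishing
at `c` is `√(c - r)` times a smooth function. -/
theorem exists_integral_eq_sqrt_mul (hδ : 0 < δ) (hκ : ContDiffOn ℝ ∞ κ (Ioo (c - δ) (c + δ)))
    (hs : ∀ r ∈ Ioo (c - δ) c, slope r = κ r / √(c - r)) :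
    ∃ m : ℝ → ℝ, ContDiffOn ℝ ∞ m (Ioo (c - δ) (c + δ)) ∧ m c = 2 * κ c ∧
      ∀ r ∈ Ioc (c - δ) c, ∫ τ in c..r, slope τ = -(√(c - r) * m r) := by
  have hball : Metric.ball (0 : ℝ) δ = Ioo (-δ) δ := by simp [Real.ball_eq_Ioo]
  have hshift : MapsTo (fun z : ℝ => c + z) (Ioo (-δ) δ) (Ioo (c - δ) (c + δ)) := fun z hz =>
    ⟨by linarith [hz.1], by linarith [hz.2]⟩
  have hunshift : MapsTo (fun r : ℝ => r - c) (Ioo (c - δ) (c + δ)) (Ioo (-δ) δ) := fun z hz =>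
    ⟨by linarith [hz.1], by linarith [hz.2]⟩
  have h1 : ContDiffOn ℝ ∞ (fun z => ∫ t in (0 : ℝ)..1, 2 * κ (c + t ^ 2 * z)) (Ioo (-δ) δ) := by
    have := contDiffOn_integral_smul_comp_smul (E := ℝ) (ρ := δ) (f := fun z => κ (c + z))
      (by rw [hball]; exact hκ.comp (contDiff_const.add contDiff_id).contDiffOn hshift)
      (continuous_pow 2) (continuous_const (y := (2 : ℝ)))
      (fun t ht => by
        rw [abs_of_nonneg (sq_nonneg t)]
        exact pow_le_one₀ ht.1 ht.2)
    simpa [hball] using this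
  refine ⟨fun r => ∫ t in (0 : ℝ)..1, 2 * κ (c + t ^ 2 * (r - c)),
    h1.comp (contDiff_id.sub contDiff_const).contDiffOn hunshift, by simp, fun r hr => ?_⟩
  set k : ℝ → ℝ := fun z => κ (c - z ^ 2) with hk
  set W : ℝ → ℝ := fun y => ∫ z in (0 : ℝ)..y, k z with hW
  have hkc : ContinuousOn k (Ioo (-√δ) √δ) := by
    refine hκ.continuousOn.comp (by fun_prop) fun z hz => ?_
    have : z ^ 2 < δ := by
      rw [← Real.sq_sqrt hδ.le]
      exact sq_lt_sq' hz.1 hz.2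
    exact ⟨by linarith, by linarith [sq_nonneg z]⟩
  have hsδ : 0 < √δ := Real.sqrt_pos.2 hδ
  have hWd : ∀ y ∈ Ioo (-√δ) √δ, HasDerivAt W (k y) y := fun y hy =>
    intervalIntegral.integral_hasDerivAt_right
      ((hkc.mono (ordConnected_Ioo.uIcc_subset ⟨by linarith, hsδ⟩ hy)).intervalIntegrable)
      (hkc.stronglyMeasurableAtFilter isOpen_Ioo y hy) (hkc.continuousAt (isOpen_Ioo.mem_nhds hy))
  have hsq : ∀ τ ∈ Icc r c, √(c - τ) ∈ Ioo (-√δ) √δ := fun τ hτ =>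
    ⟨by linarith [Real.sqrt_nonneg (c - τ)],
      Real.sqrt_lt_sqrt (by linarith [hτ.2]) (by linarith [hr.1, hτ.1])⟩
  have hint := intervalIntegrable_of_eq_div_sqrt hκ.continuousOn hs hr
  have hFTC : ∫ τ in r..c, slope τ = (-2 * W √(c - c)) - (-2 * W √(c - r)) := by
    refine intervalIntegral.integral_eq_sub_of_hasDerivAt_of_le
      (f := fun τ => -2 * W √(c - τ)) hr.2 ?_ (fun τ hτ => ?_) hint
    · refine continuousOn_const.mul ((continuousOn_of_forall_continuousAt fun y hy =>
        (hWd y hy).continuousAt).comp (by fun_prop) hsq)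
    · have hpos : 0 < c - τ := by linarith [hτ.2]
      have h2 := (hWd _ (hsq τ (Ioo_subset_Icc_self hτ))).comp τ
        (((hasDerivAt_id τ).const_sub c).sqrt hpos.ne')
      refine (h2.const_mul (-2)).congr_deriv ?_
      rw [hs τ ⟨hr.1.trans hτ.1, hτ.2⟩, hk]
      simp only [id, Real.sq_sqrt hpos.le, sub_sub_cancel]
      have := Real.sqrt_pos.2 hpos
      field_simp
  have hW0 : W √(c - c) = 0 := by simp [hW]
  have hWr : W √(c - r) = √(c - r) * ∫ t in (0 : ℝ)..1, κ (c + t ^ 2 * (r - c)) := by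
    have h3 := intervalIntegral.mul_integral_comp_mul_left (a := 0) (b := 1) (f := k) √(c - r)
    rw [mul_zero, mul_one] at h3
    simp only [hW]
    rw [← h3]
    congr 1
    refine intervalIntegral.integral_congr fun t _ => ?_
    simp only [hk, mul_pow, Real.sq_sqrt (show 0 ≤ c - r by linarith [hr.2])]
    congr 1
    ring
  simp only [intervalIntegral.integral_const_mul]
  rw [intervalIntegral.integral_symm, hFTC, hW0, hWr]
  ring

end

/-! ### The slope of the radial solution -/

/-- The quotient `u'(r) / r` of the radial solution, written so that it makes sense at `r = 0`. -/
noncomputable def slopeQuotient (n : ℕ) (η ψ : ℝ → ℝ) (H₀ r : ℝ) : ℝ :=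
  Real.exp (ψ r) * ((n * H₀ * volumeQuotient n η ψ r)
    / √(volumeDensity n η ψ r ^ 2 - (r * (n * H₀ * volumeQuotient n η ψ r)) ^ 2))

theorem heightDensity_nonneg (n : ℕ) (ξ ψ : ℝ → ℝ) (H₀ r : ℝ) : 0 ≤ heightDensity n ξ ψ H₀ r := by
  unfold heightDensity
  positivity

/-- The standing assumptions on the radius `r₀` and the mean curvature `H₀`, on a regular model. -/
structure IsCriticalRadius (n : ℕ) (r₁ : ℝ) (ξ η ψ : ℝ → ℝ) (H₀ r₀ : ℝ) : Prop
    extends IsRegularModel n r₁ ξ η ψ where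
  mem : r₀ ∈ Ioo 0 r₁
  antitone : AntitoneOn (fun r => weightedArea n ξ ψ r / weightedVolume n ξ ψ r) (Ioo 0 r₁)
  critical : n * |H₀| = weightedArea n ξ ψ r₀ / weightedVolume n ξ ψ r₀
  deriv_neg : deriv (fun r => weightedArea n ξ ψ r / weightedVolume n ξ ψ r) r₀ < 0

namespace IsCriticalRadius

variable {n : ℕ} {r₁ : ℝ} {ξ η ψ : ℝ → ℝ} {H₀ r₀ : ℝ}

theorem mem_of_mem (h : IsCriticalRadius n r₁ ξ η ψ H₀ r₀) {r : ℝ} (hr : r ∈ Ioo 0 r₀) :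
    r ∈ Ioo 0 r₁ := ⟨hr.1, hr.2.trans h.mem.2⟩

theorem ne_zero (h : IsCriticalRadius n r₁ ξ η ψ H₀ r₀) : H₀ ≠ 0 := by
  rintro rfl
  have h1 := h.critical
  have h2 := div_pos (h.weightedArea_pos h.mem) (h.weightedVolume_pos h.mem)
  rw [abs_zero, mul_zero] at h1
  linarith

/-- The hypothesis on the derivative makes the monotone quotient strictly larger than its value at
`r₀` at all smaller radii. -/
theorem lt_div (h : IsCriticalRadius n r₁ ξ η ψ H₀ r₀) {r : ℝ} (hr : r ∈ Ioo 0 r₀) :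
    n * |H₀| < weightedArea n ξ ψ r / weightedVolume n ξ ψ r := by
  set q : ℝ → ℝ := fun r => weightedArea n ξ ψ r / weightedVolume n ξ ψ r with hq
  have hd : HasDerivAt q (deriv q r₀) r₀ :=
    (differentiableAt_of_deriv_ne_zero h.deriv_neg.ne).hasDerivAt
  have h1 : ∀ᶠ s in 𝓝[<] r₀, _root_.slope q r₀ s < 0 :=
    ((hasDerivAt_iff_tendsto_slope.1 hd).mono_left
      (nhdsWithin_mono _ fun s (hs : s < r₀) => hs.ne)).eventually_lt_const h.deriv_neg
  obtain ⟨s, hs, hs'⟩ := (h1.and (Ioo_mem_nhdsLT hr.2)).exists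
  rw [slope_def_field, div_neg_iff] at hs
  have h2 : q r₀ < q s := by
    rcases hs with hs | hs
    · linarith [hs.1]
    · linarith [hs.2, hs'.2]
  have h3 : q s ≤ q r :=
    h.antitone (h.mem_of_mem hr) (h.mem_of_mem ⟨hr.1.trans hs'.1, hs'.2⟩) hs'.1.le
  calc n * |H₀| = q r₀ := h.critical
    _ < q s := h2
    _ ≤ q r := h3

theorem flux_sq_lt (h : IsCriticalRadius n r₁ ξ η ψ H₀ r₀) {r : ℝ} (hr : r ∈ Ioo 0 r₀) :
    flux n ξ ψ H₀ r ^ 2 < weightedArea n ξ ψ r ^ 2 := by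
  have hV := h.weightedVolume_pos (h.mem_of_mem hr)
  have h1 := (lt_div_iff₀ hV).1 (h.lt_div hr)
  rw [sq_lt_sq, abs_of_pos (h.weightedArea_pos (h.mem_of_mem hr)), flux_eq, abs_mul, abs_mul,
    abs_of_pos hV, Nat.abs_cast]
  exact h1

theorem radicand_eq (h : IsCriticalRadius n r₁ ξ η ψ H₀ r₀) {r : ℝ} (hr : r ∈ Ico 0 r₁) :
    weightedArea n ξ ψ r ^ 2 - flux n ξ ψ H₀ r ^ 2 = (r ^ (n - 1)) ^ 2 *
      (volumeDensity n η ψ r ^ 2 - (r * (n * H₀ * volumeQuotient n η ψ r)) ^ 2) := by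
  rw [flux_eq, h.weightedArea_eq hr, h.weightedVolume_eq hr, ← mul_pow_sub_one h.dim_ne_zero r]
  ring

theorem radicand_pos (h : IsCriticalRadius n r₁ ξ η ψ H₀ r₀) {r : ℝ} (hr : r ∈ Ico 0 r₀) :
    0 < volumeDensity n η ψ r ^ 2 - (r * (n * H₀ * volumeQuotient n η ψ r)) ^ 2 := by
  have hr' : r ∈ Ico 0 r₁ := ⟨hr.1, hr.2.trans h.mem.2⟩
  rcases hr.1.eq_or_lt with rfl | h0
  · rw [zero_mul, zero_pow two_ne_zero, sub_zero]
    exact pow_pos (h.volumeDensity_pos hr') 2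
  · have h1 := sub_pos.2 (h.flux_sq_lt ⟨h0, hr.2⟩)
    rw [h.radicand_eq hr'] at h1
    exact pos_of_mul_pos_right h1 (sq_nonneg _)

theorem radialSlope_eq_mul (h : IsCriticalRadius n r₁ ξ η ψ H₀ r₀) {r : ℝ} (hr : r ∈ Ico 0 r₀) :
    radialSlope n ξ ψ H₀ r = r * slopeQuotient n η ψ H₀ r := by
  have hr' : r ∈ Ico 0 r₁ := ⟨hr.1, hr.2.trans h.mem.2⟩
  rw [radialSlope_eq, h.radicand_eq hr', Real.sqrt_mul (sq_nonneg _),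
    Real.sqrt_sq (pow_nonneg hr.1 _), flux_eq, h.weightedVolume_eq hr', slopeQuotient]
  rcases hr.1.eq_or_lt with rfl | h0
  · simp [h.dim_ne_zero]
  · have h1 := Real.sqrt_pos.2 (h.radicand_pos hr)
    have h2 : 0 < r ^ (n - 1) := pow_pos h0 _
    rw [← mul_pow_sub_one h.dim_ne_zero r]
    field_simp

theorem smooth_slopeQuotient (h : IsCriticalRadius n r₁ ξ η ψ H₀ r₀) :
    ContDiffOn ℝ ∞ (fun x : Base n => slopeQuotient n η ψ H₀ ‖x‖) (Metric.ball 0 r₀) := by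
  have hsub : Metric.ball (0 : Base n) r₀ ⊆ Metric.ball 0 r₁ := Metric.ball_subset_ball h.mem.2.le
  have hψ := h.smooth_weight.mono hsub
  have hB := h.smooth_volumeDensity.mono hsub
  have hK : ContDiffOn ℝ ∞ (fun x : Base n => n * H₀ * volumeQuotient n η ψ ‖x‖)
      (Metric.ball 0 r₀) := contDiffOn_const.mul (h.smooth_volumeQuotient.mono hsub)
  have hpos : ∀ x ∈ Metric.ball (0 : Base n) r₀, 0 < volumeDensity n η ψ ‖x‖ ^ 2
      - ‖x‖ ^ 2 * (n * H₀ * volumeQuotient n η ψ ‖x‖) ^ 2 := fun x hx => by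
    rw [← mul_pow]
    exact h.radicand_pos ⟨norm_nonneg x, mem_ball_zero_iff.1 hx⟩
  have hs := ((hB.pow 2).sub ((contDiff_norm_sq ℝ).contDiffOn.mul (hK.pow 2))).sqrt
    fun x hx => (hpos x hx).ne'
  refine (hψ.exp.mul (hK.div hs fun x hx => (Real.sqrt_pos.2 (hpos x hx)).ne')).congr
    fun x _ => ?_
  simp only [slopeQuotient, mul_pow, Pi.div_apply]

theorem slopeQuotient_zero (h : IsCriticalRadius n r₁ ξ η ψ H₀ r₀) :
    slopeQuotient n η ψ H₀ 0 = Real.exp (ψ 0) * H₀ := by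
  have h1 := h.volumeQuotient_zero
  have h2 : volumeDensity n η ψ 0 = Real.exp (-2 * ψ 0) := by
    simp [volumeDensity, h.quotient_zero]
  rw [slopeQuotient, h2, zero_mul, zero_pow two_ne_zero, sub_zero,
    Real.sqrt_sq (Real.exp_pos _).le, mul_right_comm, h1,
    mul_div_cancel_left₀ _ (Real.exp_pos _).ne']

theorem continuousOn_radialSlope (h : IsCriticalRadius n r₁ ξ η ψ H₀ r₀) :
    ContinuousOn (radialSlope n ξ ψ H₀) (Ico 0 r₀) :=
  (continuousOn_id.mul
    (contDiffOn_Ioo_of_comp_norm h.dim_ne_zero h.smooth_slopeQuotient).2).congr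
    fun _ hr => h.radialSlope_eq_mul hr

theorem deriv_radicand_neg (h : IsCriticalRadius n r₁ ξ η ψ H₀ r₀) :
    deriv (fun r => weightedArea n ξ ψ r ^ 2 - flux n ξ ψ H₀ r ^ 2) r₀ < 0 := by
  set q : ℝ → ℝ := fun r => weightedArea n ξ ψ r / weightedVolume n ξ ψ r with hq
  have hd : HasDerivAt q (deriv q r₀) r₀ :=
    (differentiableAt_of_deriv_ne_zero h.deriv_neg.ne).hasDerivAt
  have hV := h.hasDerivAt_weightedVolume h.mem
  have h1 := (hV.pow 2).mul ((hd.pow 2).sub_const ((n * H₀) ^ 2))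
  -- Near `r₀` the radicand is `V² ((A / V)² - n² H₀²)`, whose second factor vanishes at `r₀`.
  have h2 : (fun r => weightedArea n ξ ψ r ^ 2 - flux n ξ ψ H₀ r ^ 2) =ᶠ[𝓝 r₀]
      fun r => weightedVolume n ξ ψ r ^ 2 * (q r ^ 2 - (n * H₀) ^ 2) := by
    filter_upwards [isOpen_Ioo.mem_nhds h.mem] with r hr
    have := (h.weightedVolume_pos hr).ne'
    simp only [hq, flux_eq]
    field_simp
  have hqr : q r₀ = n * |H₀| := h.critical.symm
  have hq0 : 0 < q r₀ := div_pos (h.weightedArea_pos h.mem) (h.weightedVolume_pos h.mem)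
  have hq2 : q r₀ ^ 2 = (n * H₀) ^ 2 := by rw [hqr, mul_pow, sq_abs, mul_pow]
  have h3 := (h1.congr_of_eventuallyEq h2).deriv
  rw [h3]
  simp only [Pi.pow_apply, hq2, sub_self, mul_zero, zero_add]
  have h4 : 0 < weightedVolume n ξ ψ r₀ ^ 2 * (2 * q r₀) :=
    mul_pos (pow_pos (h.weightedVolume_pos h.mem) 2) (mul_pos two_pos hq0)
  have := mul_neg_of_pos_of_neg h4 h.deriv_neg
  simp only [Nat.cast_ofNat, Nat.add_one_sub_one, pow_one]
  linarith

/-- The radicand of the slope vanishes to first order at `r₀`, so that the slope has an inverse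
square root singularity there. -/
theorem exists_radialSlope_eq_div_sqrt (h : IsCriticalRadius n r₁ ξ η ψ H₀ r₀) :
    ∃ (δ : ℝ) (κ : ℝ → ℝ), 0 < δ ∧ δ < r₀ ∧ ContDiffOn ℝ ∞ κ (Ioo (r₀ - δ) (r₀ + δ)) ∧
      (∀ r ∈ Ioo (r₀ - δ) r₀, radialSlope n ξ ψ H₀ r = κ r / √(r₀ - r)) ∧ 0 < H₀ * κ r₀ := by
  set D : ℝ → ℝ := fun r => weightedArea n ξ ψ r ^ 2 - flux n ξ ψ H₀ r ^ 2 with hD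
  have hfl : ContDiffOn ℝ ∞ (flux n ξ ψ H₀) (Ioo 0 r₁) :=
    (contDiffOn_const.mul h.contDiffOn_weightedVolume).congr fun r _ => flux_eq n ξ ψ H₀ r
  have hDs : ContDiffOn ℝ ∞ D (Ioo 0 r₁) := (h.contDiffOn_weightedArea.pow 2).sub (hfl.pow 2)
  have hδ₀ : 0 < min r₀ (r₁ - r₀) := lt_min h.mem.1 (sub_pos.2 h.mem.2)
  obtain ⟨δ₀, hδ₀, hδ₀'⟩ := exists_between hδ₀
  rw [lt_min_iff] at hδ₀'
  have hsub : Ioo (r₀ - δ₀) (r₀ + δ₀) ⊆ Ioo 0 r₁ := fun r hr =>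
    ⟨by linarith [hr.1], by linarith [hr.2]⟩
  have hV := h.weightedVolume_pos h.mem
  have hD0 : D r₀ = 0 := by
    have h1 := (eq_div_iff hV.ne').1 h.critical
    simp only [hD, flux_eq]
    rw [← h1, mul_pow, mul_pow, mul_pow, mul_pow, sq_abs, sub_self]
  obtain ⟨E, hE, hDE, hE0⟩ := exists_contDiffOn_eq_sub_mul (hDs.mono hsub) hD0
  have hmem : r₀ ∈ Ioo (r₀ - δ₀) (r₀ + δ₀) := ⟨by linarith, by linarith⟩
  have hEneg : ∀ᶠ r in 𝓝 r₀, E r < 0 :=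
    ((hE.continuousOn.continuousAt (isOpen_Ioo.mem_nhds hmem)).tendsto).eventually_lt_const
      (by rw [hE0]; exact h.deriv_radicand_neg)
  obtain ⟨ε, hε, hε'⟩ := Metric.eventually_nhds_iff_ball.1 hEneg
  rw [Real.ball_eq_Ioo] at hε'
  have hsub₀ : Ioo (r₀ - min ε δ₀) (r₀ + min ε δ₀) ⊆ Ioo (r₀ - δ₀) (r₀ + δ₀) := fun r hr =>
    ⟨by linarith [hr.1, min_le_right ε δ₀], by linarith [hr.2, min_le_right ε δ₀]⟩
  have hneg : ∀ r ∈ Ioo (r₀ - min ε δ₀) (r₀ + min ε δ₀), 0 < -E r := fun r hr =>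
    neg_pos.2 (hε' r ⟨by linarith [hr.1, min_le_left ε δ₀], by linarith [hr.2, min_le_left ε δ₀]⟩)
  have hψ := (contDiffOn_Ioo_of_comp_norm h.dim_ne_zero h.smooth_weight).1
  have hδ : 0 < min ε δ₀ := lt_min hε hδ₀
  refine ⟨min ε δ₀, fun r => Real.exp (ψ r) * (flux n ξ ψ H₀ r / √(-E r)), hδ,
    (min_le_right _ _).trans_lt hδ₀'.1, ?_, fun r hr => ?_, ?_⟩
  · exact (hψ.mono (hsub₀.trans hsub)).exp.mul ((hfl.mono (hsub₀.trans hsub)).div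
      ((hE.mono hsub₀).neg.sqrt fun r hr => (hneg r hr).ne')
      fun r hr => (Real.sqrt_pos.2 (hneg r hr)).ne')
  · have hr' : r ∈ Ioo (r₀ - min ε δ₀) (r₀ + min ε δ₀) := ⟨hr.1, by linarith [hr.2]⟩
    have h1 : D r = (-E r) * (r₀ - r) := by
      rw [hDE r (hsub₀ hr')]
      ring
    rw [radialSlope_eq]
    change Real.exp (ψ r) * (flux n ξ ψ H₀ r / √(D r)) = _
    rw [h1, Real.sqrt_mul (hneg r hr').le, ← div_div, mul_div_assoc]
  · have h1 := Real.sqrt_pos.2 (hneg r₀ ⟨by linarith, by linarith⟩)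
    have h2 : 0 < H₀ * flux n ξ ψ H₀ r₀ := by
      rw [flux_eq]
      have h3 : 0 < H₀ ^ 2 := by have := h.ne_zero; positivity
      have h4 : 0 < (n : ℝ) := Nat.cast_pos.2 (Nat.pos_of_ne_zero h.dim_ne_zero)
      have := mul_pos (mul_pos h4 h3) hV
      linarith
    have h5 : H₀ * (Real.exp (ψ r₀) * (flux n ξ ψ H₀ r₀ / √(-E r₀)))
        = Real.exp (ψ r₀) * (H₀ * flux n ξ ψ H₀ r₀ / √(-E r₀)) := by ring
    rw [h5]
    exact mul_pos (Real.exp_pos _) (div_pos h2 h1)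

theorem intervalIntegrable_radialSlope (h : IsCriticalRadius n r₁ ξ η ψ H₀ r₀) :
    IntervalIntegrable (radialSlope n ξ ψ H₀) volume 0 r₀ := by
  obtain ⟨δ, κ, hδ, hδ', hκ, hs, -⟩ := h.exists_radialSlope_eq_div_sqrt
  have ha : r₀ - δ / 2 ∈ Ioc (r₀ - δ) r₀ := ⟨by linarith, by linarith⟩
  refine IntervalIntegrable.trans (b := r₀ - δ / 2) ?_
    (intervalIntegrable_of_eq_div_sqrt hκ.continuousOn hs ha)
  refine (h.continuousOn_radialSlope.mono fun t ht => ?_).intervalIntegrable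
  rw [uIcc_of_le (by linarith)] at ht
  exact ⟨ht.1, by linarith [ht.2]⟩

/-! ### The height density -/

/-- The height density is `e^{-ψ}` times the absolute value of the slope. -/
theorem abs_radialSlope (h : IsCriticalRadius n r₁ ξ η ψ H₀ r₀) {r : ℝ} (hr : r ∈ Ioo 0 r₀) :
    |radialSlope n ξ ψ H₀ r| = Real.exp (ψ r) * heightDensity n ξ ψ H₀ r := by
  have hV := h.weightedVolume_pos (h.mem_of_mem hr)
  have h1 : weightedArea n ξ ψ r ^ 2 - flux n ξ ψ H₀ r ^ 2 = weightedVolume n ξ ψ r ^ 2 *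
      (weightedArea n ξ ψ r ^ 2 / weightedVolume n ξ ψ r ^ 2 - (n : ℝ) ^ 2 * H₀ ^ 2) := by
    rw [flux_eq]
    field_simp
  rw [radialSlope_eq, abs_mul, Real.abs_exp, abs_div, abs_of_nonneg (Real.sqrt_nonneg _), h1,
    Real.sqrt_mul (sq_nonneg _), Real.sqrt_sq hV.le, heightDensity, flux_eq, abs_mul, abs_mul,
    abs_of_pos hV, Nat.abs_cast, mul_comm (weightedVolume n ξ ψ r), mul_div_mul_right _ _ hV.ne']

theorem intervalIntegrable_heightDensity (h : IsCriticalRadius n r₁ ξ η ψ H₀ r₀) :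
    IntervalIntegrable (heightDensity n ξ ψ H₀) volume 0 r₀ := by
  have hψ := (contDiffOn_Ioo_of_comp_norm h.dim_ne_zero h.smooth_weight).2
  have h1 : IntervalIntegrable (fun r => Real.exp (-ψ r) * |radialSlope n ξ ψ H₀ r|)
      volume 0 r₀ := by
    refine h.intervalIntegrable_radialSlope.abs.continuousOn_mul
      ((hψ.mono fun t ht => ?_).neg.rexp)
    rw [uIcc_of_le h.mem.1.le] at ht
    exact ⟨ht.1, ht.2.trans_lt h.mem.2⟩
  refine h1.congr_ae ?_
  rw [uIoc_of_le h.mem.1.le, ← restrict_Ioo_eq_restrict_Ioc]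
  filter_upwards [ae_restrict_mem measurableSet_Ioo] with r hr
  rw [h.abs_radialSlope hr, ← mul_assoc, ← Real.exp_add, neg_add_cancel, Real.exp_zero, one_mul]

/-- A bound `C` for the ratios `e^{ψ(τ)} / e^{ψ(r)}` bounds the height by `C` times the integral of
the height density. -/
theorem abs_integral_radialSlope_le (h : IsCriticalRadius n r₁ ξ η ψ H₀ r₀) {C r : ℝ}
    (hr : r ∈ Ico 0 r₀) (hC : ∀ τ ∈ Ico 0 r₀, Real.exp (ψ τ - ψ r) ≤ C) :
    Real.exp (-ψ r) * |∫ τ in r₀..r, radialSlope n ξ ψ H₀ τ|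
      ≤ C * ∫ τ in (0 : ℝ)..r₀, heightDensity n ξ ψ H₀ τ := by
  have hC0 : 0 ≤ C := (Real.exp_pos _).le.trans (hC r hr)
  have hsub : uIcc r r₀ ⊆ uIcc 0 r₀ := by
    rw [uIcc_of_le hr.2.le, uIcc_of_le h.mem.1.le]
    exact Icc_subset_Icc_left hr.1
  have hs := h.intervalIntegrable_radialSlope.mono_set hsub
  have hh := h.intervalIntegrable_heightDensity.mono_set hsub
  have h1 : |∫ τ in r₀..r, radialSlope n ξ ψ H₀ τ| ≤ ∫ τ in r..r₀, |radialSlope n ξ ψ H₀ τ| := by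
    rw [intervalIntegral.integral_symm, abs_neg]
    exact intervalIntegral.abs_integral_le_integral_abs hr.2.le
  have h2 : Real.exp (-ψ r) * ∫ τ in r..r₀, |radialSlope n ξ ψ H₀ τ|
      ≤ ∫ τ in r..r₀, C * heightDensity n ξ ψ H₀ τ := by
    rw [← intervalIntegral.integral_const_mul]
    refine intervalIntegral.integral_mono_on_of_le_Ioo hr.2.le (hs.abs.const_mul _)
      (hh.const_mul _) fun τ hτ => ?_
    have hτ' : τ ∈ Ioo 0 r₀ := ⟨hr.1.trans_lt hτ.1, hτ.2⟩
    rw [h.abs_radialSlope hτ', ← mul_assoc, ← Real.exp_add, neg_add_eq_sub]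
    exact mul_le_mul_of_nonneg_right (hC τ (Ioo_subset_Ico_self hτ'))
      (heightDensity_nonneg n ξ ψ H₀ τ)
  have h3 : ∫ τ in r..r₀, heightDensity n ξ ψ H₀ τ
      ≤ ∫ τ in (0 : ℝ)..r₀, heightDensity n ξ ψ H₀ τ :=
    intervalIntegral.integral_mono_interval hr.1 hr.2.le le_rfl
      (Eventually.of_forall fun τ => heightDensity_nonneg n ξ ψ H₀ τ)
      h.intervalIntegrable_heightDensity
  rw [intervalIntegral.integral_const_mul] at h2
  exact (mul_le_mul_of_nonneg_left h1 (Real.exp_pos _).le).trans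
    (h2.trans (mul_le_mul_of_nonneg_left h3 hC0))

end IsCriticalRadius

/-! ### The radial solution -/

/-- The profile `u` of the rotationally symmetric graph, vanishing at `r₀`. -/
noncomputable def radialSolution (n : ℕ) (ξ ψ : ℝ → ℝ) (H₀ r₀ r : ℝ) : ℝ :=
  ∫ τ in r₀..r, radialSlope n ξ ψ H₀ τ

theorem radialSolution_self {n : ℕ} {ξ ψ : ℝ → ℝ} {H₀ r₀ : ℝ} :
    radialSolution n ξ ψ H₀ r₀ r₀ = 0 :=
  intervalIntegral.integral_same

/-- The equation `(ν p)' - 2ψ' ν p + (n - 1) (ξ'/ξ) ν p = n H₀`, where `ν p = I / A`, after the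
derivative of `ν p` has been expanded. Here `c = n H₀`, `e = e^ψ`, `S = √(A² - I²)` and
`L = (n - 1) ξ'/ξ`. -/
theorem weighted_mean_curvature_identity {e A I S c L ψ' p' : ℝ} (he : e ≠ 0) (hA : A ≠ 0)
    (hS : S ≠ 0) (hS2 : S ^ 2 = A ^ 2 - I ^ 2)
    (hp' : p' = e * ψ' * (I / S) + e * (c * A / S - I * (A * (A * (L - 2 * ψ')) - I * (c * A))
      / S ^ 3)) :
    S / (e * A) * ((p' - 2 * ψ' * (e * (I / S)) - ψ' * (e ^ 2)⁻¹ * (e * (I / S)) ^ 3)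
      / (1 + (e ^ 2)⁻¹ * (e * (I / S)) ^ 2) + e * (I / S) * L) - ψ' * (S / (e * A)) * (e * (I / S))
      = c := by
  have h1 : 1 + (e ^ 2)⁻¹ * (e * (I / S)) ^ 2 = A ^ 2 / S ^ 2 := by
    field_simp
    linarith
  rw [h1, hp']
  field_simp
  have h3 : I ^ 2 = A ^ 2 - S ^ 2 := by linear_combination hS2
  ring_nf
  simp only [h3, show I ^ 3 = I * (A ^ 2 - S ^ 2) by rw [← h3]; ring]
  ring

theorem hasFDerivAt_height {n : ℕ} (p : Ambient n) :
    HasFDerivAt (fun q : Ambient n => q.2) (ContinuousLinearMap.snd ℝ (Base n) ℝ) p :=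
  hasFDerivAt_snd

theorem mem_graphOver_iff {n : ℕ} {f : Base n → ℝ} {D : Set (Base n)} {q : Ambient n} :
    q ∈ graphOver f D ↔ q.1 ∈ D ∧ q.2 = f q.1 := by
  constructor
  · rintro ⟨x, hx, rfl⟩
    exact ⟨hx, rfl⟩
  · rintro ⟨h1, h2⟩
    exact ⟨q.1, h1, Prod.ext rfl h2.symm⟩

namespace IsCriticalRadius

variable {n : ℕ} {r₁ : ℝ} {ξ η ψ : ℝ → ℝ} {H₀ r₀ : ℝ}

theorem continuousOn_radialSolution (h : IsCriticalRadius n r₁ ξ η ψ H₀ r₀) :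
    ContinuousOn (radialSolution n ξ ψ H₀ r₀) (Icc 0 r₀) := by
  have := intervalIntegral.continuousOn_primitive_interval' h.intervalIntegrable_radialSlope
    right_mem_uIcc
  rwa [uIcc_of_le h.mem.1.le] at this

theorem hasDerivAt_radialSolution (h : IsCriticalRadius n r₁ ξ η ψ H₀ r₀) {r : ℝ}
    (hr : r ∈ Ioo 0 r₀) :
    HasDerivAt (radialSolution n ξ ψ H₀ r₀) (r * slopeQuotient n η ψ H₀ r) r := by
  have hc : ContinuousOn (radialSlope n ξ ψ H₀) (Ioo 0 r₀) :=
    h.continuousOn_radialSlope.mono Ioo_subset_Ico_self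
  rw [← h.radialSlope_eq_mul (Ioo_subset_Ico_self hr)]
  refine intervalIntegral.integral_hasDerivAt_right (h.intervalIntegrable_radialSlope.mono_set ?_)
    (hc.stronglyMeasurableAtFilter isOpen_Ioo r hr) (hc.continuousAt (isOpen_Ioo.mem_nhds hr))
  rw [uIcc_of_ge hr.2.le, uIcc_of_le h.mem.1.le]
  exact Icc_subset_Icc_left hr.1.le

theorem hasFDerivAt_radialSolution (h : IsCriticalRadius n r₁ ξ η ψ H₀ r₀) {x : Base n}
    (hx : x ∈ Metric.ball 0 r₀) :
    HasFDerivAt (fun y : Base n => radialSolution n ξ ψ H₀ r₀ ‖y‖)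
      (slopeQuotient n η ψ H₀ ‖x‖ • innerSL ℝ x) x :=
  hasFDerivAt_comp_norm (h.continuousOn_radialSolution.mono Ico_subset_Icc_self)
    (fun _ hr => h.hasDerivAt_radialSolution hr) h.smooth_slopeQuotient.continuousOn hx

theorem contDiffOn_radialSolution (h : IsCriticalRadius n r₁ ξ η ψ H₀ r₀) :
    ContDiffOn ℝ ∞ (fun y : Base n => radialSolution n ξ ψ H₀ r₀ ‖y‖) (Metric.ball 0 r₀) :=
  (contDiffOn_comp_norm_succ (m := ⊤)
    (h.continuousOn_radialSolution.mono Ico_subset_Icc_self)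
    (fun _ hr => h.hasDerivAt_radialSolution hr) h.smooth_slopeQuotient).of_le (by simp)

theorem continuousOn_radialSolution_norm (h : IsCriticalRadius n r₁ ξ η ψ H₀ r₀) :
    ContinuousOn (fun y : Base n => radialSolution n ξ ψ H₀ r₀ ‖y‖) (Metric.closedBall 0 r₀) :=
  h.continuousOn_radialSolution.comp continuous_norm.continuousOn fun x hx =>
    ⟨norm_nonneg x, mem_closedBall_zero_iff.1 hx⟩

theorem hasWeightedMeanCurvatureAt_of_ne (h : IsCriticalRadius n r₁ ξ η ψ H₀ r₀) {x : Base n}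
    (hx : x ∈ Metric.ball 0 r₀) (hx0 : x ≠ 0)
    {ξ' ψ' : ℝ} (hξ : HasDerivAt ξ ξ' ‖x‖) (hψ : HasDerivAt ψ ψ' ‖x‖) :
    HasWeightedMeanCurvatureAt ξ ψ (fun y : Base n => radialSolution n ξ ψ H₀ r₀ ‖y‖) x H₀ := by
  have hr : ‖x‖ ∈ Ioo 0 r₀ := ⟨norm_pos_iff.2 hx0, mem_ball_zero_iff.1 hx⟩
  have hr' := h.mem_of_mem hr
  have hn : (n : ℝ) ≠ 0 := Nat.cast_ne_zero.2 h.dim_ne_zero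
  set A := weightedArea n ξ ψ ‖x‖ with hAdef
  set I := flux n ξ ψ H₀ ‖x‖ with hIdef
  have hA : 0 < A := h.weightedArea_pos hr'
  have hD : 0 < A ^ 2 - I ^ 2 := sub_pos.2 (h.flux_sq_lt hr)
  set S := √(A ^ 2 - I ^ 2) with hSdef
  have hS : 0 < S := Real.sqrt_pos.2 hD
  have hS2 : S ^ 2 = A ^ 2 - I ^ 2 := Real.sq_sqrt hD.le
  set L := (n - 1) * ξ' / ξ ‖x‖ with hL
  have hA' : HasDerivAt (weightedArea n ξ ψ) (A * (L - 2 * ψ')) ‖x‖ :=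
    h.hasDerivAt_weightedArea hr' hξ hψ
  have hI' : HasDerivAt (flux n ξ ψ H₀) (n * H₀ * A) ‖x‖ := by
    rw [funext (flux_eq n ξ ψ H₀)]
    exact (h.hasDerivAt_weightedVolume hr').const_mul _
  have hp : HasDerivAt (radialSlope n ξ ψ H₀) (Real.exp (ψ ‖x‖) * ψ' * (I / S)
      + Real.exp (ψ ‖x‖) * (n * H₀ * A / S - I * (A * (A * (L - 2 * ψ')) - I * (n * H₀ * A))
        / S ^ 3)) ‖x‖ := by
    rw [funext (radialSlope_eq n ξ ψ H₀)]
    have h1 : HasDerivAt (fun r => √(weightedArea n ξ ψ r ^ 2 - flux n ξ ψ H₀ r ^ 2)) _ ‖x‖ :=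
      ((hA'.pow 2).sub (hI'.pow 2)).sqrt hD.ne'
    refine (hψ.exp.mul (hI'.div h1 hS.ne')).congr_deriv ?_
    simp only [Pi.div_apply, Pi.sub_apply, Pi.pow_apply, ← hAdef, ← hIdef, ← hSdef]
    field_simp
    ring
  have hpx : radialSlope n ξ ψ H₀ ‖x‖ = Real.exp (ψ ‖x‖) * (I / S) := radialSlope_eq n ξ ψ H₀ ‖x‖
  have hf : ∀ᶠ y in 𝓝 x, HasFDerivAt (fun y : Base n => radialSolution n ξ ψ H₀ r₀ ‖y‖)
      (radialSlope n ξ ψ H₀ ‖y‖ • radialForm y) y := by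
    filter_upwards [Metric.isOpen_ball.mem_nhds hx, isOpen_ne.mem_nhds hx0] with y hy hy0
    have hy' : ‖y‖ ≠ 0 := norm_ne_zero_iff.2 hy0
    refine (h.hasFDerivAt_radialSolution hy).congr_fderiv ?_
    rw [h.radialSlope_eq_mul ⟨norm_nonneg y, mem_ball_zero_iff.1 hy⟩, radialForm, smul_smul]
    congr 1
    field_simp
  have he2 : Real.exp (2 * ψ ‖x‖) = Real.exp (ψ ‖x‖) ^ 2 := by
    rw [← Real.exp_nat_mul]; norm_num
  have he2' : Real.exp (-2 * ψ ‖x‖) = (Real.exp (ψ ‖x‖) ^ 2)⁻¹ := by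
    rw [← he2, ← Real.exp_neg]; congr 1; ring
  have hν1 : (S / (Real.exp (ψ ‖x‖) * A)) ^ 2
      * (radialSlope n ξ ψ H₀ ‖x‖ ^ 2 + Real.exp (2 * ψ ‖x‖)) = 1 := by
    rw [hpx, he2]
    field_simp
    linear_combination hS2
  have key := hasWeightedMeanCurvatureAt_of_ne_zero hx0 hξ (h.warping_pos _ hr').ne' hψ hp hf
    (div_pos hS (mul_pos (Real.exp_pos _) hA)) hν1
  convert key using 1
  rw [eq_div_iff hn, hpx, he2', mul_comm H₀]
  refine (weighted_mean_curvature_identity (L := L) (ψ' := ψ') (Real.exp_pos (ψ ‖x‖)).ne'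
    hA.ne' hS.ne' hS2 rfl).symm.trans ?_
  have : (n - 1) * (Real.exp (ψ ‖x‖) * (I / S) * ξ' / ξ ‖x‖) = Real.exp (ψ ‖x‖) * (I / S) * L := by
    rw [hL]; ring
  rw [this]

theorem hasWeightedMeanCurvatureAt (h : IsCriticalRadius n r₁ ξ η ψ H₀ r₀)
    (hξ : DifferentiableOn ℝ ξ (Ioo 0 r₁)) {x : Base n} (hx : x ∈ Metric.ball 0 r₀) :
    HasWeightedMeanCurvatureAt ξ ψ (fun y : Base n => radialSolution n ξ ψ H₀ r₀ ‖y‖) x H₀ := by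
  rcases eq_or_ne x 0 with rfl | hx0
  · have h0 : (0 : Base n) ∈ Metric.ball 0 r₁ := by simpa using h.radius_pos
    have h1 : Real.exp (-ψ 0) * slopeQuotient n η ψ H₀ 0 = H₀ := by
      rw [h.slopeQuotient_zero, ← mul_assoc, ← Real.exp_add, neg_add_cancel, Real.exp_zero, one_mul]
    have hd : ∀ {f : Base n → ℝ} {a : ℝ}, ContDiffOn ℝ ∞ f (Metric.ball 0 a) →
        (0 : Base n) ∈ Metric.ball 0 a → DifferentiableAt ℝ f 0 := fun hf ha =>
      (hf.contDiffAt (Metric.isOpen_ball.mem_nhds ha)).differentiableAt (by simp)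
    have key := hasWeightedMeanCurvatureAt_zero (ξ := ξ) (h := slopeQuotient n η ψ H₀)
      (f := fun y : Base n => radialSolution n ξ ψ H₀ r₀ ‖y‖) h.dim_ne_zero
      (hd h.smooth_quotient h0) h.quotient_zero ?_ (hd h.smooth_weight h0)
      (hd h.smooth_slopeQuotient hx) ?_
    · rwa [h1] at key
    · filter_upwards [Metric.isOpen_ball.mem_nhds h0] with y hy
      exact h.warping_eq _ ⟨norm_nonneg y, mem_ball_zero_iff.1 hy⟩
    · filter_upwards [Metric.isOpen_ball.mem_nhds hx] with y hy
      exact h.hasFDerivAt_radialSolution hy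
  · have hr : ‖x‖ ∈ Ioo 0 r₁ := h.mem_of_mem ⟨norm_pos_iff.2 hx0, mem_ball_zero_iff.1 hx⟩
    have hψ := (contDiffOn_Ioo_of_comp_norm h.dim_ne_zero h.smooth_weight).1
    exact h.hasWeightedMeanCurvatureAt_of_ne hx hx0
      (hξ.hasDerivAt (isOpen_Ioo.mem_nhds hr))
      ((hψ.differentiableOn (by simp)).hasDerivAt (isOpen_Ioo.mem_nhds hr))

/-! ### The graph as a hypersurface with boundary -/

/-- Near its boundary the graph is `{s² = (r₀ - r) m(r)², H₀ s ≤ 0}` with `m` smooth and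
`m(r₀) ≠ 0`, although its profile has infinite slope there. -/
theorem exists_radialSolution_eq_sqrt_mul (h : IsCriticalRadius n r₁ ξ η ψ H₀ r₀) :
    ∃ (δ : ℝ) (m : ℝ → ℝ), 0 < δ ∧ δ < r₀ ∧ ContDiffOn ℝ ∞ m (Ioo (r₀ - δ) (r₀ + δ)) ∧
      (∀ r ∈ Ioo (r₀ - δ) (r₀ + δ), 0 < H₀ * m r) ∧
      ∀ r ∈ Ioc (r₀ - δ) r₀, radialSolution n ξ ψ H₀ r₀ r = -(√(r₀ - r) * m r) := by
  obtain ⟨δ, κ, hδ, hδ', hκ, hs, hpos⟩ := h.exists_radialSlope_eq_div_sqrt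
  obtain ⟨m, hm, hm0, hu⟩ := exists_integral_eq_sqrt_mul hδ hκ hs
  have hmem : r₀ ∈ Ioo (r₀ - δ) (r₀ + δ) := ⟨by linarith, by linarith⟩
  have h1 : ∀ᶠ r in 𝓝 r₀, 0 < H₀ * m r := by
    refine ((hm.continuousOn.continuousAt (isOpen_Ioo.mem_nhds hmem)).tendsto.const_mul
      H₀).eventually_const_lt ?_
    rw [hm0]
    linarith
  obtain ⟨ε, hε, hε'⟩ := Metric.eventually_nhds_iff_ball.1 h1
  rw [Real.ball_eq_Ioo] at hε'
  have hle : ∀ {r}, r₀ - min ε δ < r → r₀ - ε < r ∧ r₀ - δ < r := fun hr =>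
    ⟨by linarith [min_le_left ε δ], by linarith [min_le_right ε δ]⟩
  have hge : ∀ {r}, r < r₀ + min ε δ → r < r₀ + ε ∧ r < r₀ + δ := fun hr =>
    ⟨by linarith [min_le_left ε δ], by linarith [min_le_right ε δ]⟩
  exact ⟨min ε δ, m, lt_min hε hδ, (min_le_right _ _).trans_lt hδ',
    hm.mono fun r hr => ⟨(hle hr.1).2, (hge hr.2).2⟩,
    fun r hr => hε' r ⟨(hle hr.1).1, (hge hr.2).1⟩, fun r hr => hu r ⟨(hle hr.1).2, hr.2⟩⟩

theorem isSmoothHypersurfaceWithBoundary_graphOver (h : IsCriticalRadius n r₁ ξ η ψ H₀ r₀) :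
    IsSmoothHypersurfaceWithBoundary
      (graphOver (fun x : Base n => radialSolution n ξ ψ H₀ r₀ ‖x‖) (Metric.closedBall 0 r₀))
      (Metric.sphere (0 : Base n) r₀ ×ˢ {(0 : ℝ)}) := by
  refine ⟨?_, ?_, ?_⟩
  · rintro ⟨x, s⟩ ⟨hx, hs⟩
    rw [mem_sphere_zero_iff_norm] at hx
    rw [mem_singleton_iff] at hs
    rw [mem_graphOver_iff, mem_closedBall_zero_iff]
    exact ⟨hx.le, by simp only [hx, radialSolution_self]; exact hs⟩
  · rintro ⟨x, s⟩ ⟨hS, hB⟩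
    rw [mem_graphOver_iff, mem_closedBall_zero_iff] at hS
    have hx : x ∈ Metric.ball (0 : Base n) r₀ := by
      refine mem_ball_zero_iff.2 (hS.1.lt_of_ne fun hx => hB ?_)
      refine ⟨mem_sphere_zero_iff_norm.2 hx, ?_⟩
      have h2 := hS.2
      simp only at hx h2
      rw [hx, radialSolution_self] at h2
      exact h2
    have hO : IsOpen (Metric.ball (0 : Base n) r₀ ×ˢ (univ : Set ℝ)) :=
      Metric.isOpen_ball.prod isOpen_univ
    have hF : HasFDerivAt
        (fun q : Ambient n => q.2 - radialSolution n ξ ψ H₀ r₀ ‖q.1‖) _ (x, s) :=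
      (hasFDerivAt_height _).sub (hasFDerivAt_comp_fst (h.hasFDerivAt_radialSolution hx) s)
    refine ⟨_, fun q => q.2 - radialSolution n ξ ψ H₀ r₀ ‖q.1‖, hO, ⟨hx, mem_univ _⟩, ?_, ?_, ?_⟩
    · exact contDiff_snd.contDiffOn.sub
        (h.contDiffOn_radialSolution.comp contDiff_fst.contDiffOn fun q hq => hq.1)
    · rw [hF.fderiv]
      intro h0
      have := DFunLike.congr_fun h0 ((0, 1) : Ambient n)
      simp at this
    · rintro ⟨y, t⟩ ⟨hy, -⟩
      rw [mem_graphOver_iff, sub_eq_zero]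
      exact ⟨fun h1 => h1.2, fun h1 => ⟨Metric.ball_subset_closedBall hy, h1⟩⟩
  · obtain ⟨δ, m, hδ, hδ', hm, hpos, hu⟩ := h.exists_radialSolution_eq_sqrt_mul
    rintro ⟨x, s⟩ ⟨hx, hs⟩
    rw [mem_sphere_zero_iff_norm] at hx
    rw [mem_singleton_iff] at hs
    simp only at hx hs
    subst hs
    have hx0 : x ≠ 0 := norm_ne_zero_iff.1 (by rw [hx]; exact h.mem.1.ne')
    have hmem : r₀ ∈ Ioo (r₀ - δ) (r₀ + δ) := ⟨by linarith, by linarith⟩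
    have hm0 : ∀ r ∈ Ioo (r₀ - δ) (r₀ + δ), m r ≠ 0 := fun r hr h0 => by
      have := hpos r hr
      rw [h0, mul_zero] at this
      exact lt_irrefl _ this
    have hO : IsOpen {q : Ambient n | ‖q.1‖ ∈ Ioo (r₀ - δ) (r₀ + δ)} :=
      isOpen_Ioo.preimage (continuous_norm.comp continuous_fst)
    set φ : ℝ → ℝ := fun r => (r₀ - r) * m r ^ 2 with hφ
    have hφd : HasDerivAt φ (-(m r₀ ^ 2)) ‖x‖ := by
      rw [hx]
      have h1 := (hm.differentiableOn (by simp)).hasDerivAt (isOpen_Ioo.mem_nhds hmem)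
      refine (((hasDerivAt_id r₀).const_sub r₀).mul (h1.pow 2)).congr_deriv ?_
      simp
    have hF : HasFDerivAt (fun q : Ambient n => q.2 ^ 2 - φ ‖q.1‖) _ (x, (0 : ℝ)) :=
      ((hasFDerivAt_height _).pow 2).sub (hasFDerivAt_comp_fst
        (hφd.comp_hasFDerivAt x (hasFDerivAt_norm_radialForm hx0)) 0)
    have hG : HasFDerivAt (fun q : Ambient n => -(H₀ * q.2)) _ (x, (0 : ℝ)) :=
      ((hasFDerivAt_height _).const_mul H₀).neg
    have hB : ∀ q : Ambient n, ‖q.1‖ ∈ Ioo (r₀ - δ) (r₀ + δ) →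
        (q ∈ Metric.sphere (0 : Base n) r₀ ×ˢ {(0 : ℝ)} ↔
          q.2 ^ 2 - φ ‖q.1‖ = 0 ∧ -(H₀ * q.2) = 0) := by
      rintro ⟨y, t⟩ hy
      simp only at hy
      simp only [mem_prod, mem_sphere_zero_iff_norm, mem_singleton_iff, neg_eq_zero, mul_eq_zero,
        h.ne_zero, false_or]
      constructor
      · rintro ⟨h1, rfl⟩
        simp [hφ, h1]
      · rintro ⟨h1, rfl⟩
        have h2 : (r₀ - ‖y‖) * m ‖y‖ ^ 2 = 0 := by simpa [hφ] using h1
        rcases mul_eq_zero.1 h2 with h2 | h2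
        · exact ⟨by linarith, rfl⟩
        · exact absurd (pow_eq_zero_iff two_ne_zero |>.1 h2) (hm0 _ hy)
    refine ⟨_, fun q => q.2 ^ 2 - φ ‖q.1‖, fun q => -(H₀ * q.2), hO, ?_, ?_, ?_, ?_, ?_, hB⟩
    · simpa only [mem_ofPred_eq, hx] using hmem
    · refine (contDiff_snd.pow 2).contDiffOn.sub ?_
      have hnorm : ContDiffOn ℝ ∞ (fun q : Ambient n => ‖q.1‖)
          {q : Ambient n | ‖q.1‖ ∈ Ioo (r₀ - δ) (r₀ + δ)} := by
        refine contDiff_fst.contDiffOn.norm ℝ fun q hq => norm_pos_iff.1 ?_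
        linarith [hq.1]
      exact (contDiffOn_const.sub hnorm).mul ((hm.comp hnorm fun q hq => hq).pow 2)
    · exact (contDiff_const.mul contDiff_snd).neg.contDiffOn
    · rw [hF.fderiv, hG.fderiv, LinearIndependent.pair_iff]
      intro a b hab
      have h1 := DFunLike.congr_fun hab ((0, 1) : Ambient n)
      have h2 := DFunLike.congr_fun hab ((‖x‖⁻¹ • x, 0) : Ambient n)
      have h3 := radialForm_unit hx0
      simp only [map_smul, smul_eq_mul] at h3
      simp [h.ne_zero] at h1
      simp [h3, hm0 r₀ hmem] at h2
      exact ⟨h2, h1⟩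
    · rintro ⟨y, t⟩ hy
      have hy' : ‖y‖ ∈ Ioo (r₀ - δ) (r₀ + δ) := hy
      rw [mem_graphOver_iff, mem_closedBall_zero_iff]
      constructor
      · rintro ⟨h1, h2⟩
        simp only at h1 h2 ⊢
        rw [hu ‖y‖ ⟨hy'.1, h1⟩] at h2
        subst h2
        have h3 : 0 ≤ √(r₀ - ‖y‖) * (H₀ * m ‖y‖) :=
          mul_nonneg (Real.sqrt_nonneg _) (hpos _ hy').le
        refine ⟨?_, by linarith⟩
        rw [neg_sq, mul_pow, Real.sq_sqrt (by linarith)]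
        simp [hφ]
      · rintro ⟨h1, h2⟩
        simp only [hφ] at h1 h2 ⊢
        have h3 : 0 < m ‖y‖ ^ 2 := by have := hm0 _ hy'; positivity
        have h4 : ‖y‖ ≤ r₀ := by
          have h5 : 0 ≤ (r₀ - ‖y‖) * m ‖y‖ ^ 2 := by linarith [sq_nonneg t]
          linarith [nonneg_of_mul_nonneg_left h5 h3]
        refine ⟨h4, ?_⟩
        rw [hu ‖y‖ ⟨hy'.1, h4⟩]
        have h5 : √(r₀ - ‖y‖) ^ 2 = r₀ - ‖y‖ := Real.sq_sqrt (by linarith)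
        have h6 : (t - √(r₀ - ‖y‖) * m ‖y‖) * (t + √(r₀ - ‖y‖) * m ‖y‖) = 0 := by
          linear_combination h1 - m ‖y‖ ^ 2 * h5
        rcases mul_eq_zero.1 h6 with h7 | h7
        · -- The wrong branch meets `H₀ s ≤ 0` only where `s = 0`.
          have h8 : √(r₀ - ‖y‖) * (H₀ * m ‖y‖) ≤ 0 := by
            have h9 : t = √(r₀ - ‖y‖) * m ‖y‖ := by linarith
            rw [h9] at h2
            linarith
          have h9 : √(r₀ - ‖y‖) = 0 :=
            le_antisymm (nonpos_of_mul_nonpos_left h8 (hpos _ hy')) (Real.sqrt_nonneg _)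
          rw [h9, zero_mul, sub_zero] at h7
          rw [h9, zero_mul, neg_zero, h7]
        · linarith

end IsCriticalRadius

theorem mainTheorem9 (n : ℕ) (hn : 1 ≤ n) (R : EReal) (ξ ψ : ℝ → ℝ)
    (hξ : IsWarpingFunction R ξ)
    (hψ : ContDiffOn ℝ ∞ (fun x : Base n => ψ ‖x‖) (modelBall n R))
    (hmono : AntitoneOn (fun r => weightedArea n ξ ψ r / weightedVolume n ξ ψ r)
      {r : ℝ | 0 < r ∧ (r : EReal) < R})
    (H₀ r₀ : ℝ) (hr₀ : 0 < r₀) (hr₀R : (r₀ : EReal) < R)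
    (hH₀ : n * |H₀| = weightedArea n ξ ψ r₀ / weightedVolume n ξ ψ r₀)
    (hstrict : deriv (fun r => weightedArea n ξ ψ r / weightedVolume n ξ ψ r) r₀ < 0) :
    IntervalIntegrable (radialSlope n ξ ψ H₀) MeasureTheory.volume 0 r₀ ∧
    IntervalIntegrable (heightDensity n ξ ψ H₀) MeasureTheory.volume 0 r₀ ∧
    ∃ u : ℝ → ℝ,
      (∀ r ∈ Set.Icc 0 r₀, u r = ∫ τ in r₀..r, radialSlope n ξ ψ H₀ τ) ∧
      ContinuousOn (fun x : Base n => u ‖x‖) (Metric.closedBall 0 r₀) ∧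
      ContDiffOn ℝ ∞ (fun x : Base n => u ‖x‖) (Metric.ball 0 r₀) ∧
      IsCompact (graphOver (fun x : Base n => u ‖x‖) (Metric.closedBall 0 r₀)) ∧
      IsSmoothHypersurfaceWithBoundary
        (graphOver (fun x : Base n => u ‖x‖) (Metric.closedBall 0 r₀))
        (Metric.sphere (0 : Base n) r₀ ×ˢ {(0 : ℝ)}) ∧
      (∀ x ∈ Metric.ball (0 : Base n) r₀,
        HasWeightedMeanCurvatureAt ξ ψ (fun y : Base n => u ‖y‖) x H₀) ∧
      (∀ r ∈ Set.Icc 0 r₀,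
        Real.exp (-ψ r) * |u r| ≤
          Real.exp (sSup ((fun x : Base n => ψ ‖x‖) '' Metric.ball 0 r₀)
              - sInf ((fun x : Base n => ψ ‖x‖) '' Metric.ball 0 r₀))
            * ∫ τ in (0 : ℝ)..r₀, heightDensity n ξ ψ H₀ τ) := by
  have hn0 : n ≠ 0 := Nat.one_le_iff_ne_zero.1 hn
  obtain ⟨r₁, h01, h1R⟩ := EReal.lt_iff_exists_real_btwn.1 hr₀R
  rw [EReal.coe_lt_coe_iff] at h01
  have hlt : ∀ {r : ℝ}, r < r₁ → (r : EReal) < R := fun h => (EReal.coe_lt_coe h).trans h1R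
  obtain ⟨η, hη⟩ := hξ.exists_isRegularModel hn0 hψ (hr₀.trans h01) h1R
  have h : IsCriticalRadius n r₁ ξ η ψ H₀ r₀ :=
    ⟨hη, ⟨hr₀, h01⟩, hmono.mono fun r hr => ⟨hr.1, hlt hr.2⟩, hH₀, hstrict⟩
  have hξd : DifferentiableOn ℝ ξ (Ioo 0 r₁) :=
    (hξ.smooth.differentiableOn (by simp)).mono fun r hr => ⟨hr.1.le, hlt hr.2⟩
  refine ⟨h.intervalIntegrable_radialSlope, h.intervalIntegrable_heightDensity,
    radialSolution n ξ ψ H₀ r₀, fun r _ => rfl, h.continuousOn_radialSolution_norm,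
    h.contDiffOn_radialSolution, ?_, h.isSmoothHypersurfaceWithBoundary_graphOver,
    fun x hx => h.hasWeightedMeanCurvatureAt hξd hx, fun r hr => ?_⟩
  · exact (isCompact_closedBall _ _).image_of_continuousOn
      (continuousOn_id.prodMk h.continuousOn_radialSolution_norm)
  · rcases hr.2.eq_or_lt with rfl | hr'
    · rw [radialSolution_self, abs_zero, mul_zero]
      exact mul_nonneg (Real.exp_pos _).le (intervalIntegral.integral_nonneg hr₀.le
        fun τ _ => heightDensity_nonneg n ξ ψ H₀ τ)
    · refine h.abs_integral_radialSlope_le ⟨hr.1, hr'⟩ fun τ hτ => Real.exp_le_exp.2 ?_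
      have himg : ∀ t ∈ Ico 0 r₀, ψ t ∈ (fun x : Base n => ψ ‖x‖) '' Metric.ball 0 r₀ := by
        intro t ht
        have hnorm : ‖(EuclideanSpace.single ⟨0, hn⟩ t : Base n)‖ = t := by
          simp [abs_of_nonneg ht.1]
        refine ⟨EuclideanSpace.single ⟨0, hn⟩ t, ?_, ?_⟩
        · rw [mem_ball_zero_iff, hnorm]
          exact ht.2
        · simp only [hnorm]
      have hcpt : IsCompact ((fun x : Base n => ψ ‖x‖) '' Metric.closedBall 0 r₀) :=
        (isCompact_closedBall _ _).image_of_continuousOn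
          (h.smooth_weight.continuousOn.mono (Metric.closedBall_subset_ball h01))
      have hsub := image_mono (f := fun x : Base n => ψ ‖x‖)
        (Metric.ball_subset_closedBall (x := (0 : Base n)) (ε := r₀))
      exact sub_le_sub (le_csSup (hcpt.bddAbove.mono hsub) (himg τ hτ))
        (csInf_le (hcpt.bddBelow.mono hsub) (himg r ⟨hr.1, hr'⟩))
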